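/- Let $N\subseteq M$ be a unital inclusion of finite-dimensional $C^*$-algebras that is connected, i.e. $Z(N)\cap Z(M)=\mathbb C1$ (equivalently, its Bratteli diagram is connected), and let $tr$ be its Markov trace, of modulus $\tau$: $tr$ is a faithful tracial state on $M$ that extends to a positive trace $Tr$ on the basic construction $M_1=\langle M,e_1\rangle$ with $Tr(xe_1)=\tau\,tr(x)$ for all $x\in M$. Here $\langle M,e_1\rangle$ is the algebra of operators on $L^2(M,tr)$ generated by $M$, acting by left multiplication, and by the orthogonal projection $e_1$ of $L^2(M,tr)$ onto the subspace $N$. Then $Tr$ is a Markov trace of modulus $\tau$ for $M\subseteq M_1$, and iterating the construction, with $M_{-1}=N$, $M_0=M$ and $M_{n+1}=\langle M_n,e_{n+1}\rangle$ the basic construction of $M_{n-1}\subseteq M_n$, gives the Jones tower $$N\subseteq M\subseteq M_1\subseteq M_2\subseteq\cdots$$ and a trace, again denoted $tr$, on $M_\infty=\bigcup_n M_n$. Let $R$ be the von Neumann algebra generated by $M_\infty$ in its GNS representation on $L^2(M_\infty,tr)$, with the trace $tr_R(x)=\langle\Omega,x\Omega\rangle$ that extends $tr$, where $\Omega$ is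 the class of $1$ (if $N\neq M$, then $R$ is the hyperfinite $II_1$ factor). Let $\alpha_0$ be a $*$-automorphism of $M$ with $\alpha_0(N)=N$. Then there is a $*$-automorphism $\alpha$ of $R$ such that 1. $\alpha|_M=\alpha_0$, 2. $\alpha(e_i)=e_i$ for all $i\ge 1$, 3. $\alpha(M_i)=M_i$ for all $i\ge 0$, and there is only one $*$-automorphism of $R$ with the properties 1–3. Moreover $\alpha$ preserves the trace: $tr_R\circ\alpha=tr_R$. -/

import Mathlib

open scoped ComplexOrder InnerProductSpace

noncomputable section

namespace JonesTower

set_option linter.unusedSectionVars false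

universe u

section Trace

variable {A : Type u} [Ring A] [StarRing A] [Algebra ℂ A] [StarModule ℂ A]

/-- A faithful tracial state on a complex star algebra. -/
structure IsFaithfulTracialState (tr : A →ₗ[ℂ] ℂ) : Prop where
  map_one : tr 1 = 1
  tracial : ∀ a b, tr (a * b) = tr (b * a)
  pos : ∀ a, a ≠ 0 → 0 < tr (star a * a)

variable {tr : A →ₗ[ℂ] ℂ}

lemma IsFaithfulTracialState.nonneg (h : IsFaithfulTracialState tr) (a : A) :
    0 ≤ tr (star a * a) := by
  by_cases ha : a = 0
  · simp [ha]
  · exact (h.pos a ha).le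

lemma IsFaithfulTracialState.map_star (h : IsFaithfulTracialState tr) (a : A) :
    tr (star a) = star (tr a) := by
  have h0 := (Complex.nonneg_iff.1 (h.nonneg a)).2
  have h1 := (Complex.nonneg_iff.1 (h.nonneg (1 + a))).2
  have h2 := (Complex.nonneg_iff.1 (h.nonneg (1 + Complex.I • a))).2
  simp only [star_add, star_one, star_smul, add_mul, mul_add, one_mul, mul_one, map_add, h.map_one,
    smul_mul_assoc, mul_smul_comm, map_smul, smul_eq_mul, Complex.add_im, Complex.mul_im,
    Complex.star_def, Complex.conj_I, Complex.neg_re, Complex.neg_im, Complex.I_re, Complex.I_im,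
    Complex.one_im, Complex.mul_re, ← h0] at h1 h2
  apply Complex.ext
  · simp only [Complex.star_def, Complex.conj_re]; linarith
  · simp only [Complex.star_def, Complex.conj_im]; linarith

/-- The algebra `A` with the inner product `⟪a, b⟫ = tr (a* b)`. -/
def L2 (_h : IsFaithfulTracialState tr) : Type u := A

variable (h : IsFaithfulTracialState tr)

instance : AddCommGroup (L2 h) := inferInstanceAs (AddCommGroup A)
instance : Module ℂ (L2 h) := inferInstanceAs (Module ℂ A)
instance [FiniteDimensional ℂ A] : FiniteDimensional ℂ (L2 h) :=
  inferInstanceAs (FiniteDimensional ℂ A)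

/-- The identity map `A → L²(A, tr)`. -/
def toL2 : A ≃ₗ[ℂ] L2 h := LinearEquiv.refl ℂ A

/-- The inner product of `L²(A, tr)`. -/
abbrev l2Core : InnerProductSpace.Core ℂ (L2 h) where
  inner x y := tr (star ((toL2 h).symm x) * (toL2 h).symm y)
  conj_inner_symm x y := by
    have := h.map_star (star ((toL2 h).symm y) * (toL2 h).symm x)
    simpa using this.symm
  re_inner_nonneg x := (Complex.nonneg_iff.1 (h.nonneg ((toL2 h).symm x))).1
  add_left x y z := by simp [add_mul]
  smul_left x y r := by simp
  definite x hx := by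
    by_contra hne
    exact absurd hx (h.pos _ (by simpa using hne)).ne'

instance : NormedAddCommGroup (L2 h) := (l2Core h).toNormedAddCommGroup
instance : InnerProductSpace ℂ (L2 h) := InnerProductSpace.ofCore (l2Core h).toCore

lemma inner_toL2 (a b : A) : ⟪toL2 h a, toL2 h b⟫_ℂ = tr (star a * b) := rfl

end Trace

section BasicConstruction

variable {A : Type u} [Ring A] [StarRing A] [Algebra ℂ A] [StarModule ℂ A]
  [FiniteDimensional ℂ A] {tr : A →ₗ[ℂ] ℂ} (h : IsFaithfulTracialState tr)

instance : CompleteSpace (L2 h) := FiniteDimensional.complete ℂ (L2 h)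

/-- The representation of `A` on `L²(A, tr)` by left multiplication. -/
def leftMul : A →⋆ₐ[ℂ] (L2 h →L[ℂ] L2 h) where
  toFun a := LinearMap.toContinuousLinearMap
    ((toL2 h).toLinearMap ∘ₗ LinearMap.mulLeft ℂ a ∘ₗ (toL2 h).symm.toLinearMap)
  map_one' := by ext x; simp
  map_mul' a b := by ext x; simp
  map_zero' := by ext x; simp
  map_add' a b := by ext x; simp [add_mul]
  commutes' r := by ext x; simp [Algebra.algebraMap_eq_smul_one]
  map_star' a := by
    refine (ContinuousLinearMap.eq_adjoint_iff _ _).2 fun x y => ?_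
    obtain ⟨x, rfl⟩ := (toL2 h).surjective x
    obtain ⟨y, rfl⟩ := (toL2 h).surjective y
    simp [inner_toL2, mul_assoc]

@[simp]
lemma leftMul_toL2 (a b : A) : leftMul h a (toL2 h b) = toL2 h (a * b) := rfl

/-- The Jones projection: the orthogonal projection of `L²(A, tr)` onto the closed subspace of the
subalgebra `N`; it implements the trace-preserving conditional expectation of `A` onto `N`. -/
def jonesProj (N : StarSubalgebra ℂ A) : L2 h →L[ℂ] L2 h :=
  ((Subalgebra.toSubmodule N.toSubalgebra).map (toL2 h).toLinearMap).starProjection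

/-- The basic construction `⟨A, e⟩` of `N ⊆ A`: the algebra of operators on `L²(A, tr)` generated
by `A`, acting by left multiplication, and by the Jones projection `e`. -/
def basicConstruction (N : StarSubalgebra ℂ A) : StarSubalgebra ℂ (L2 h →L[ℂ] L2 h) :=
  StarAlgebra.adjoin ℂ (Set.range (leftMul h) ∪ {jonesProj h N})

variable (N : StarSubalgebra ℂ A)

/-- The inclusion of `A` in the basic construction. -/
def basicIncl : A →⋆ₐ[ℂ] basicConstruction h N :=
  (leftMul h).codRestrict _ fun a => StarAlgebra.subset_adjoin ℂ _ (Or.inl ⟨a, rfl⟩)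

/-- The Jones projection as an element of the basic construction. -/
def basicProj : basicConstruction h N :=
  ⟨jonesProj h N, StarAlgebra.subset_adjoin ℂ _ (Or.inr rfl)⟩

instance : FiniteDimensional ℂ (basicConstruction h N) :=
  inferInstanceAs (FiniteDimensional ℂ
    (Subalgebra.toSubmodule (basicConstruction h N).toSubalgebra))

end BasicConstruction

section Markov

variable {A : Type u} [Ring A] [StarRing A] [Algebra ℂ A] [StarModule ℂ A]
  [FiniteDimensional ℂ A]

/-- `tr` is a Markov trace of modulus `τ` for the inclusion `N ⊆ A`: a faithful tracial state that
extends to a positive trace `Tr` on the basic construction with `Tr (a e) = τ tr a`. -/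
def IsMarkovTrace (N : StarSubalgebra ℂ A) (tr : A →ₗ[ℂ] ℂ) (τ : ℝ) : Prop :=
  ∃ h : IsFaithfulTracialState tr, ∃ Tr : basicConstruction h N →ₗ[ℂ] ℂ,
    (∀ x y, Tr (x * y) = Tr (y * x)) ∧ (∀ x, 0 ≤ Tr (star x * x)) ∧
    (∀ a, Tr (basicIncl h N a) = tr a) ∧
    ∀ a, Tr (basicIncl h N a * basicProj h N) = τ * tr a

end Markov

section CondExp

variable {A : Type u} [Ring A] [StarRing A] [Algebra ℂ A] [StarModule ℂ A]
  [FiniteDimensional ℂ A] {tr : A →ₗ[ℂ] ℂ} (h : IsFaithfulTracialState tr)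
  (N : StarSubalgebra ℂ A)

/-- The trace-preserving conditional expectation of `A` onto `N`. -/
def condExp : A →ₗ[ℂ] A :=
  (toL2 h).symm.toLinearMap ∘ₗ (jonesProj h N).toLinearMap ∘ₗ (toL2 h).toLinearMap

lemma jonesProj_toL2 (a : A) : jonesProj h N (toL2 h a) = toL2 h (condExp h N a) := rfl

lemma condExp_mem (a : A) : condExp h N a ∈ N := by
  obtain ⟨b, hb, hb'⟩ := Submodule.starProjection_apply_mem
    ((Subalgebra.toSubmodule N.toSubalgebra).map (toL2 h).toLinearMap) (toL2 h a)
  have : condExp h N a = b := (toL2 h).injective hb'.symm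
  rw [this]; exact hb

lemma tr_mul_condExp (a : A) {b : A} (hb : b ∈ N) : tr (b * condExp h N a) = tr (b * a) := by
  have := Submodule.starProjection_inner_eq_zero
    (K := (Subalgebra.toSubmodule N.toSubalgebra).map (toL2 h).toLinearMap) (toL2 h a)
    (toL2 h (star b)) ⟨star b, (star_mem hb : star b ∈ N), rfl⟩
  rw [← inner_conj_symm, map_eq_zero] at this
  change ⟪toL2 h (star b), toL2 h (a - condExp h N a)⟫_ℂ = 0 at this
  rw [inner_toL2, star_star, mul_sub, map_sub, sub_eq_zero] at this
  exact this.symm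

variable {N} in
lemma condExp_eq {a c : A} (hc : c ∈ N) (hac : ∀ b ∈ N, tr (b * c) = tr (b * a)) :
    condExp h N a = c := by
  by_contra hne
  have hm : condExp h N a - c ∈ N := sub_mem (condExp_mem h N a) hc
  refine (h.pos _ (sub_ne_zero.2 hne)).ne' ?_
  rw [mul_sub, map_sub, tr_mul_condExp h N a (star_mem hm), hac _ (star_mem hm), sub_self]

variable {N} in
lemma condExp_mul_right (a : A) {b : A} (hb : b ∈ N) :
    condExp h N (a * b) = condExp h N a * b := by
  refine condExp_eq h (mul_mem (condExp_mem h N a) hb) fun c hc => ?_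
  rw [← mul_assoc, h.tracial, ← mul_assoc, tr_mul_condExp h N a (mul_mem hb hc), mul_assoc,
    h.tracial b, mul_assoc]

variable {N} in
lemma condExp_mul_left (a : A) {b : A} (hb : b ∈ N) :
    condExp h N (b * a) = b * condExp h N a := by
  refine condExp_eq h (mul_mem hb (condExp_mem h N a)) fun c hc => ?_
  rw [← mul_assoc, tr_mul_condExp h N a (mul_mem hc hb), mul_assoc]

/-- An operator on `L²(A, tr)` regarded as a map `A → A`. -/
def act (x : L2 h →L[ℂ] L2 h) : A →ₗ[ℂ] A :=
  (toL2 h).symm.toLinearMap ∘ₗ x.toLinearMap ∘ₗ (toL2 h).toLinearMap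

lemma toL2_act (x : L2 h →L[ℂ] L2 h) (a : A) : toL2 h (act h x a) = x (toL2 h a) := rfl

lemma tr_star_mul_act (x : L2 h →L[ℂ] L2 h) (a b : A) :
    tr (star a * act h (star x) b) = tr (star (act h x a) * b) := by
  have := ContinuousLinearMap.adjoint_inner_right x (toL2 h a) (toL2 h b)
  exact this

lemma ext_tr (h : IsFaithfulTracialState tr) {a b : A} (hab : ∀ c, tr (star c * a) = tr (star c * b)) : a = b := by
  by_contra hne
  refine (h.pos _ (sub_ne_zero.2 hne)).ne' ?_
  rw [mul_sub, map_sub, hab, sub_self]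

/-- Elements of the basic construction commute with right multiplication by `N`. -/
lemma act_mul {x : L2 h →L[ℂ] L2 h} (hx : x ∈ basicConstruction h N) (a : A) {b : A}
    (hb : b ∈ N) : act h x (a * b) = act h x a * b := by
  induction hx using StarAlgebra.adjoin_induction generalizing a b with
  | mem x hx =>
    rcases hx with ⟨c, rfl⟩ | rfl
    · exact (mul_assoc c a b).symm
    · exact condExp_mul_right h a hb
  | algebraMap r =>
    change r • (a * b) = (r • a) * b
    rw [smul_mul_assoc]
  | add x y _ _ hx hy =>
    change act h x (a * b) + act h y (a * b) = (act h x a + act h y a) * b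
    rw [hx a hb, hy a hb, add_mul]
  | mul x y _ _ hx hy =>
    change act h x (act h y (a * b)) = act h x (act h y a) * b
    rw [hy a hb, hx _ hb]
  | star x _ hx =>
    refine ext_tr h fun c => ?_
    rw [tr_star_mul_act, ← mul_assoc, ← mul_assoc, h.tracial _ b, h.tracial _ b, ← mul_assoc,
      ← mul_assoc, ← star_star b, ← star_mul, ← star_mul, tr_star_mul_act, hx _ (star_mem hb)]

/-- A finite family `g` with `∑ gᵢ E (gᵢ* a) = a` for all `a`. -/
lemma exists_basis : ∃ (n : ℕ) (g : Fin n → A),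
    ∀ a, ∑ i, g i * condExp h N (star (g i) * a) = a := by
  classical
  let n := Module.finrank ℂ A
  let b : Module.Basis (Fin n) ℂ A := Module.finBasis ℂ A
  let e := jonesProj h N
  have hee : e = e * star e := by
    have h1 : IsStarProjection e := isStarProjection_starProjection
    rw [h1.isSelfAdjoint.star_eq, h1.isIdempotentElem.eq]
  let P : L2 h →L[ℂ] L2 h := ∑ i, leftMul h (b i) * e * star (leftMul h (b i))
  have hP : 0 ≤ P := Finset.sum_nonneg fun i _ => by
    rw [hee, ← mul_assoc, mul_assoc _ (star e), ← star_mul]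
    exact mul_star_self_nonneg _
  have hPact : ∀ a, act h P a = ∑ i, b i * condExp h N (star (b i) * a) := by
    intro a
    apply (toL2 h).injective
    rw [toL2_act, map_sum, sum_apply]
    refine Finset.sum_congr rfl fun i _ => ?_
    rw [← map_star]
    rfl
  have hinj : Function.Injective P := by
    rw [injective_iff_map_eq_zero]
    intro x hx
    obtain ⟨a, rfl⟩ := (toL2 h).surjective x
    have h0 : ∑ i, tr (star (condExp h N (star (b i) * a)) * condExp h N (star (b i) * a)) = 0 := by
      have : tr (star a * act h P a) = 0 := by
        have : act h P a = 0 := (toL2 h).injective (by rw [toL2_act, hx, map_zero])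
        rw [this, mul_zero, map_zero]
      rw [hPact, Finset.mul_sum, map_sum] at this
      rw [← this]
      refine Finset.sum_congr rfl fun i _ => ?_
      rw [tr_mul_condExp h N _ (star_mem (condExp_mem h N _))]
      have h2 := h.map_star (star (condExp h N (star (b i) * a)) * (star (b i) * a))
      have h3 := tr_mul_condExp h N (star (b i) * a)
        (star_mem (condExp_mem h N (star (b i) * a)))
      have h4 := h.map_star (star (condExp h N (star (b i) * a)) * condExp h N (star (b i) * a))
      rw [star_mul, star_star, h3, ← h2] at h4
      rw [h4, star_mul, star_star, star_mul, star_star, mul_assoc]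
    have h1 : ∀ i, condExp h N (star (b i) * a) = 0 := by
      intro i
      by_contra hne
      have := (Finset.sum_eq_zero_iff_of_nonneg (fun i _ => h.nonneg _)).1 h0 i (Finset.mem_univ i)
      exact (h.pos _ hne).ne' this
    have h2 : ∀ c, tr (star c * a) = 0 := by
      intro c
      rw [← b.sum_repr c, star_sum, Finset.sum_mul, map_sum]
      refine Finset.sum_eq_zero fun i _ => ?_
      have := tr_mul_condExp h N (star (b i) * a) (one_mem N)
      rw [h1, mul_zero, map_zero, one_mul] at this
      rw [star_smul, smul_mul_assoc, map_smul, ← this, smul_zero]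
    have : a = 0 := ext_tr h fun c => by rw [h2, mul_zero, map_zero]
    rw [this, map_zero]
  have hunit : IsUnit P := by
    have h1 : Function.Bijective P :=
      ⟨hinj, (LinearMap.injective_iff_surjective (f := P.toLinearMap)).1 hinj⟩
    exact ContinuousLinearMap.isUnit_iff_bijective.2 h1
  let S := P ^ (-(1 / 2) : ℝ)
  have hSPS : S * P * S = 1 := by
    have h1 : S * P = P ^ (-(1 / 2) + 1 : ℝ) := by
      rw [CFC.rpow_add hunit, CFC.rpow_one P]
    rw [h1, ← CFC.rpow_add hunit]
    norm_num [CFC.rpow_zero P]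
  have hSstar : star S = S := (IsSelfAdjoint.of_nonneg CFC.rpow_nonneg).star_eq
  have hSmul : ∀ (a : A) {c : A}, c ∈ N → act h S (a * c) = act h S a * c := by
    intro a c hc
    let ρ : L2 h →L[ℂ] L2 h := LinearMap.toContinuousLinearMap
      ((toL2 h).toLinearMap ∘ₗ LinearMap.mulRight ℂ c ∘ₗ (toL2 h).symm.toLinearMap)
    have hPmem : P ∈ basicConstruction h N := sum_mem fun i _ =>
      mul_mem (mul_mem (basicIncl h N (b i)).2 (basicProj h N).2)
        (star_mem (basicIncl h N (b i)).2)
    have hcomm : Commute P ρ := by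
      ext x
      obtain ⟨x, rfl⟩ := (toL2 h).surjective x
      exact congrArg (toL2 h) (act_mul h N hPmem x hc)
    have := congrArg (fun T : L2 h →L[ℂ] L2 h => T (toL2 h a))
      (Commute.cfc_nnreal hcomm fun x => x ^ (-(1 / 2) : ℝ)).eq
    exact (toL2 h).injective this
  refine ⟨n, fun i => act h S (b i), fun a => ?_⟩
  have hE : ∀ i, condExp h N (star (act h S (b i)) * a) =
      condExp h N (star (b i) * act h S a) := by
    intro i
    refine (condExp_eq h (condExp_mem h N _) fun c hc => ?_)
    rw [tr_mul_condExp h N _ hc, ← mul_assoc, ← mul_assoc, ← star_star c, ← star_mul, ← star_mul,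
      ← hSmul _ (star_mem hc), ← tr_star_mul_act, hSstar]
  simp_rw [hE, ← hSmul _ (condExp_mem h N _)]
  rw [← map_sum, ← hPact]
  have := congrArg (fun T : L2 h →L[ℂ] L2 h => T (toL2 h a)) hSPS
  exact (toL2 h).injective this

end CondExp

section MarkovCriterion

variable {A : Type u} [Ring A] [StarRing A] [Algebra ℂ A] [StarModule ℂ A]
  [FiniteDimensional ℂ A] {tr : A →ₗ[ℂ] ℂ} (h : IsFaithfulTracialState tr)
  (N : StarSubalgebra ℂ A)

lemma condExp_star (a : A) : condExp h N (star a) = star (condExp h N a) := by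
  refine condExp_eq h (star_mem (condExp_mem h N a)) fun b hb => ?_
  rw [← star_star b, ← star_mul, ← star_mul, h.map_star, h.map_star, h.tracial,
    tr_mul_condExp h N a (star_mem hb), h.tracial]

lemma isMarkovTrace_of_basis {τ : ℝ} (hτ : (τ : ℂ) ≠ 0) {n : ℕ} (d : Fin n → A)
    (hdd : ∑ i, d i * star (d i) = 1)
    (hbasis : ∀ x, ∑ i, d i * condExp h N (star (d i) * x) = (τ : ℂ) • x) :
    IsMarkovTrace N tr τ := by
  let T : basicConstruction h N →ₗ[ℂ] ℂ :=
    ∑ i, tr ∘ₗ LinearMap.mulLeft ℂ (star (d i)) ∘ₗ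
      { toFun := fun y => act h y.1 (d i)
        map_add' := fun _ _ => rfl
        map_smul' := fun _ _ => rfl }
  have hT : ∀ y, T y = ∑ i, tr (star (d i) * act h y.1 (d i)) := by
    intro y
    rw [LinearMap.sum_apply]
    rfl
  have hTE : ∀ x, tr (condExp h N x) = tr x := by
    intro x
    have := tr_mul_condExp h N x (one_mem N)
    rwa [one_mul, one_mul] at this
  refine ⟨h, T, ?_, ?_, ?_, ?_⟩
  · have hxy : ∀ x y : basicConstruction h N, τ * T (x * y) =
        ∑ j, ∑ k, tr (condExp h N (star (d j) * act h x.1 (d k)) *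
          condExp h N (star (d k) * act h y.1 (d j))) := by
      intro x y
      rw [hT, Finset.mul_sum]
      refine Finset.sum_congr rfl fun j _ => ?_
      change (τ : ℂ) * tr (star (d j) * act h x.1 (act h y.1 (d j))) = _
      rw [← smul_eq_mul, ← map_smul, ← mul_smul_comm, ← map_smul, ← hbasis (act h y.1 (d j)),
        map_sum, Finset.mul_sum, map_sum]
      refine Finset.sum_congr rfl fun k _ => ?_
      rw [act_mul h N x.2 _ (condExp_mem h N _), ← mul_assoc, ← hTE,
        condExp_mul_right h _ (condExp_mem h N _)]
    intro x y
    refine mul_left_cancel₀ hτ ?_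
    rw [hxy, hxy, Finset.sum_comm]
    refine Finset.sum_congr rfl fun j _ => Finset.sum_congr rfl fun k _ => ?_
    rw [h.tracial]
  · intro x
    rw [hT]
    refine Finset.sum_nonneg fun i _ => ?_
    have : tr (star (d i) * act h (star x * x).1 (d i)) =
        tr (star (act h x.1 (d i)) * act h x.1 (d i)) :=
      tr_star_mul_act h x.1 (d i) (act h x.1 (d i))
    rw [this]
    exact h.nonneg _
  · intro a
    rw [hT]
    change ∑ i, tr (star (d i) * (a * d i)) = tr a
    simp_rw [h.tracial (star (d _)), mul_assoc]
    rw [← map_sum, ← Finset.mul_sum, hdd, mul_one]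
  · intro a
    rw [hT]
    change ∑ i, tr (star (d i) * (a * condExp h N (d i))) = τ * tr a
    have h1 : ∑ i, condExp h N (d i) * star (d i) = (τ : ℂ) • 1 := by
      have := congrArg star (hbasis 1)
      simpa [condExp_star] using this
    have h2 : ∀ i, tr (star (d i) * (a * condExp h N (d i))) =
        tr (a * (condExp h N (d i) * star (d i))) := by
      intro i
      rw [h.tracial, mul_assoc]
    simp_rw [h2]
    rw [← map_sum, ← Finset.mul_sum, h1, mul_smul_comm, mul_one, map_smul, smul_eq_mul]

end MarkovCriterion

section MarkovStep

variable {A : Type u} [Ring A] [StarRing A] [Algebra ℂ A] [StarModule ℂ A]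
  [FiniteDimensional ℂ A] {tr : A →ₗ[ℂ] ℂ} {N : StarSubalgebra ℂ A} {τ : ℝ}

lemma IsMarkovTrace.state (hm : IsMarkovTrace N tr τ) : IsFaithfulTracialState tr := hm.choose

/-- The Markov extension of a Markov trace to the basic construction. It is the only trace with the
properties in `IsMarkovTrace`, since `A e A` spans the basic construction. -/
def markovExt (hm : IsMarkovTrace N tr τ) : basicConstruction hm.state N →ₗ[ℂ] ℂ :=
  hm.choose_spec.choose

variable (hm : IsMarkovTrace N tr τ)

lemma markovExt_comm (x y : basicConstruction hm.state N) :
    markovExt hm (x * y) = markovExt hm (y * x) := hm.choose_spec.choose_spec.1 x y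

lemma markovExt_incl (a : A) : markovExt hm (basicIncl hm.state N a) = tr a :=
  hm.choose_spec.choose_spec.2.2.1 a

lemma markovExt_incl_mul_proj (a : A) :
    markovExt hm (basicIncl hm.state N a * basicProj hm.state N) = τ * tr a :=
  hm.choose_spec.choose_spec.2.2.2 a

lemma basic_ext {h : IsFaithfulTracialState tr} {x y : basicConstruction h N}
    (hxy : ∀ a, act h x.1 a = act h y.1 a) : x = y := by
  apply Subtype.ext
  ext v
  exact hxy v

lemma act_coe_mul {h : IsFaithfulTracialState tr} (x y : basicConstruction h N) (a : A) :
    act h (x * y : basicConstruction h N).1 a = act h x.1 (act h y.1 a) := rfl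

lemma act_incl (h : IsFaithfulTracialState tr) (c a : A) :
    act h (basicIncl h N c).1 a = c * a := rfl

lemma act_proj (h : IsFaithfulTracialState tr) (a : A) :
    act h (basicProj h N).1 a = condExp h N a := rfl

lemma basic_mul_incl_mul_proj (h : IsFaithfulTracialState tr) (x : basicConstruction h N) (a : A) :
    x * basicIncl h N a * basicProj h N = basicIncl h N (act h x.1 a) * basicProj h N := by
  refine basic_ext fun b => ?_
  rw [act_coe_mul, act_coe_mul, act_coe_mul, act_incl, act_incl, act_proj]
  exact act_mul h N x.2 a (condExp_mem h N b)

lemma basic_eq_sum {h : IsFaithfulTracialState tr} {n : ℕ} {g : Fin n → A}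
    (hg : ∀ a, ∑ i, g i * condExp h N (star (g i) * a) = a) (x : basicConstruction h N) :
    x = ∑ i, basicIncl h N (act h x.1 (g i)) * basicProj h N * basicIncl h N (star (g i)) := by
  have h1 : ∑ i, basicIncl h N (g i) * basicProj h N * basicIncl h N (star (g i)) = 1 := by
    refine basic_ext fun b => ?_
    rw [AddSubmonoidClass.coe_finsetSum]
    refine Eq.trans ?_ (hg b)
    apply (toL2 h).injective
    rw [toL2_act, sum_apply, map_sum]
    rfl
  conv_lhs => rw [← mul_one x, ← h1, Finset.mul_sum]
  refine Finset.sum_congr rfl fun i _ => ?_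
  rw [← mul_assoc, ← mul_assoc, basic_mul_incl_mul_proj]

lemma markovExt_eq {n : ℕ} {g : Fin n → A}
    (hg : ∀ a, ∑ i, g i * condExp hm.state N (star (g i) * a) = a)
    (x : basicConstruction hm.state N) :
    markovExt hm x = τ * ∑ i, tr (star (g i) * act hm.state x.1 (g i)) := by
  conv_lhs => rw [basic_eq_sum hg x]
  rw [map_sum, Finset.mul_sum]
  refine Finset.sum_congr rfl fun i _ => ?_
  rw [markovExt_comm, ← mul_assoc, ← map_mul, markovExt_incl_mul_proj]

lemma markovExt_star_mul {n : ℕ} {g : Fin n → A}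
    (hg : ∀ a, ∑ i, g i * condExp hm.state N (star (g i) * a) = a)
    (x : basicConstruction hm.state N) :
    markovExt hm (star x * x) =
      τ * ∑ i, tr (star (act hm.state x.1 (g i)) * act hm.state x.1 (g i)) := by
  rw [markovExt_eq hm hg]
  congr 1
  refine Finset.sum_congr rfl fun i _ => ?_
  exact tr_star_mul_act hm.state x.1 (g i) (act hm.state x.1 (g i))

lemma modulus_pos (hm : IsMarkovTrace N tr τ) : 0 < τ := by
  obtain ⟨n, g, hg⟩ := exists_basis hm.state N
  have h1 := markovExt_star_mul hm hg 1
  rw [mul_one, star_one, ← map_one (basicIncl hm.state N), markovExt_incl, hm.state.map_one] at h1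
  have h2 : 0 ≤ ∑ i, tr (star (act hm.state (basicIncl hm.state N 1).1 (g i)) *
      act hm.state (basicIncl hm.state N 1).1 (g i)) :=
    Finset.sum_nonneg fun i _ => hm.state.nonneg _
  obtain ⟨h3, h4⟩ := Complex.nonneg_iff.1 h2
  have h5 := congrArg Complex.re h1
  rw [Complex.re_ofReal_mul, Complex.one_re] at h5
  by_contra hneg
  nlinarith

lemma markovExt_state : IsFaithfulTracialState (markovExt hm) where
  map_one := by rw [← map_one (basicIncl hm.state N), markovExt_incl, hm.state.map_one]
  tracial := markovExt_comm hm
  pos x hx := by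
    obtain ⟨n, g, hg⟩ := exists_basis hm.state N
    rw [markovExt_star_mul hm hg]
    refine mul_pos (Complex.zero_lt_real.2 (modulus_pos hm)) ?_
    refine lt_of_le_of_ne (Finset.sum_nonneg fun i _ => hm.state.nonneg _) fun h0 => hx ?_
    have h1 : ∀ i, act hm.state x.1 (g i) = 0 := by
      intro i
      by_contra hne
      have := (Finset.sum_eq_zero_iff_of_nonneg (fun i _ => hm.state.nonneg _)).1 h0.symm i
        (Finset.mem_univ i)
      exact (hm.state.pos _ hne).ne' this
    rw [basic_eq_sum hg x]
    simp [h1]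

lemma basicProj_mul_incl (h : IsFaithfulTracialState tr) {c : A} (hc : c ∈ N) :
    basicProj h N * basicIncl h N c = basicIncl h N c * basicProj h N := by
  refine basic_ext fun b => ?_
  rw [act_coe_mul, act_coe_mul, act_incl, act_incl, act_proj, act_proj, condExp_mul_left h b hc]

lemma isStarProjection_basicProj (h : IsFaithfulTracialState tr) :
    star (basicProj h N) = basicProj h N ∧ basicProj h N * basicProj h N = basicProj h N := by
  have h1 : IsStarProjection (jonesProj h N) := isStarProjection_starProjection
  exact ⟨Subtype.ext h1.isSelfAdjoint.star_eq, Subtype.ext h1.isIdempotentElem.eq⟩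

/-- The conditional expectation of `⟨A, e⟩` onto `A` on elements `u e v`. -/
lemma condExp_incl_proj_incl (u v : A) :
    condExp (markovExt_state hm) (basicIncl hm.state N).range
      (basicIncl hm.state N u * basicProj hm.state N * basicIncl hm.state N v) =
      (τ : ℂ) • basicIncl hm.state N (u * v) := by
  refine condExp_eq _ ((basicIncl hm.state N).range.smul_mem (x := basicIncl hm.state N (u * v)) ⟨u * v, rfl⟩ (τ : ℂ)) ?_
  rintro _ ⟨w, rfl⟩
  have h1 : markovExt hm (basicIncl hm.state N w *
      (basicIncl hm.state N u * basicProj hm.state N * basicIncl hm.state N v)) =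
      τ * tr (v * w * u) := by
    rw [← markovExt_incl_mul_proj hm, ← mul_assoc, markovExt_comm,
      map_mul (basicIncl hm.state N), map_mul (basicIncl hm.state N)]
    simp only [mul_assoc]
  have h2 : markovExt hm (basicIncl hm.state N w * ((τ : ℂ) • basicIncl hm.state N (u * v))) =
      τ * tr (v * w * u) := by
    rw [mul_smul_comm, map_smul, ← map_mul, markovExt_incl, smul_eq_mul, hm.state.tracial w,
      mul_assoc, hm.state.tracial u]
  exact h2.trans h1.symm

/-- The Markov extension is again a Markov trace, of the same modulus, for `A ⊆ ⟨A, e⟩`. -/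
lemma markovExt_isMarkovTrace :
    IsMarkovTrace (basicIncl hm.state N).range (markovExt hm) τ := by
  obtain ⟨n, g, hg⟩ := exists_basis hm.state N
  obtain ⟨hestar, hee⟩ := isStarProjection_basicProj (N := N) hm.state
  have hdstar : ∀ i, star (basicIncl hm.state N (g i) * basicProj hm.state N) =
      basicProj hm.state N * basicIncl hm.state N (star (g i)) := by
    intro i
    rw [star_mul, hestar, map_star]
  refine isMarkovTrace_of_basis (markovExt_state hm) _
    (Complex.ofReal_ne_zero.2 (modulus_pos hm).ne')
    (fun i => basicIncl hm.state N (g i) * basicProj hm.state N) ?_ fun x => ?_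
  · conv_rhs => rw [basic_eq_sum hg 1]
    refine Finset.sum_congr rfl fun i _ => ?_
    rw [hdstar, mul_assoc, ← mul_assoc (basicProj hm.state N), hee, ← mul_assoc]
    rfl
  · have key : ∀ a b, ∑ i, basicIncl hm.state N (g i) * basicProj hm.state N *
        condExp (markovExt_state hm) (basicIncl hm.state N).range
          (star (basicIncl hm.state N (g i) * basicProj hm.state N) *
            (basicIncl hm.state N a * basicProj hm.state N * basicIncl hm.state N b)) =
        (τ : ℂ) • (basicIncl hm.state N a * basicProj hm.state N * basicIncl hm.state N b) := by
      intro a b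
      conv_rhs => rw [← hg a]
      rw [map_sum, Finset.sum_mul, Finset.sum_mul, Finset.smul_sum]
      refine Finset.sum_congr rfl fun i _ => ?_
      have h2 : star (basicIncl hm.state N (g i) * basicProj hm.state N) *
          (basicIncl hm.state N a * basicProj hm.state N * basicIncl hm.state N b) =
          basicIncl hm.state N (condExp hm.state N (star (g i) * a)) * basicProj hm.state N *
            basicIncl hm.state N b := by
        have h3 := basic_mul_incl_mul_proj hm.state (basicProj hm.state N) (star (g i) * a)
        change _ = basicIncl hm.state N (condExp hm.state N (star (g i) * a)) *
          basicProj hm.state N at h3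
        rw [hdstar, ← h3, map_mul]
        simp only [mul_assoc]
      rw [h2, condExp_incl_proj_incl, mul_smul_comm, map_mul (basicIncl hm.state N),
        map_mul (basicIncl hm.state N), mul_assoc (basicIncl hm.state N (g i)),
        ← mul_assoc (basicProj hm.state N),
        basicProj_mul_incl hm.state (condExp_mem hm.state N _)]
      simp only [mul_assoc]
    rw [basic_eq_sum hg x, Finset.smul_sum]
    simp_rw [Finset.mul_sum, map_sum, Finset.mul_sum]
    rw [Finset.sum_comm]
    exact Finset.sum_congr rfl fun j _ => key _ _

end MarkovStep

section Bound

variable {A : Type u} [Ring A] [StarRing A] [Algebra ℂ A] [StarModule ℂ A]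
  [FiniteDimensional ℂ A] {tr : A →ₗ[ℂ] ℂ} {N : StarSubalgebra ℂ A} {τ : ℝ}

lemma markovExt_bound (hm : IsMarkovTrace N tr τ) (a : A) {C : ℝ}
    (hC : ∀ x, tr (star (a * x) * (a * x)) ≤ C * tr (star x * x))
    (y : basicConstruction hm.state N) :
    markovExt hm (star (basicIncl hm.state N a * y) * (basicIncl hm.state N a * y)) ≤
      C * markovExt hm (star y * y) := by
  obtain ⟨n, g, hg⟩ := exists_basis hm.state N
  rw [markovExt_star_mul hm hg, markovExt_star_mul hm hg, mul_left_comm]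
  refine mul_le_mul_of_nonneg_left ?_ (Complex.zero_le_real.2 (modulus_pos hm).le)
  rw [Finset.mul_sum]
  refine Finset.sum_le_sum fun i _ => ?_
  rw [act_coe_mul, act_incl]
  exact hC _

end Bound

section Tower

/-- A unital inclusion `sub ⊆ Alg` of finite-dimensional star algebras with a Markov trace `tr` of
modulus `τ`. -/
structure MarkovInclusion (τ : ℝ) : Type (u + 1) where
  Alg : Type u
  [ring : Ring Alg]
  [starRing : StarRing Alg]
  [algebra : Algebra ℂ Alg]
  [starModule : StarModule ℂ Alg]
  [finiteDimensional : FiniteDimensional ℂ Alg]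
  sub : StarSubalgebra ℂ Alg
  tr : Alg →ₗ[ℂ] ℂ
  markov : IsMarkovTrace sub tr τ

attribute [instance] MarkovInclusion.ring MarkovInclusion.starRing MarkovInclusion.algebra
  MarkovInclusion.starModule MarkovInclusion.finiteDimensional

variable {τ : ℝ}

/-- From `N ⊆ M` with its Markov trace, the inclusion `M ⊆ M₁ = ⟨M, e₁⟩` with the Markov extension
of the trace. -/
def MarkovInclusion.next (P : MarkovInclusion.{u} τ) : MarkovInclusion.{u} τ where
  Alg := basicConstruction P.markov.state P.sub
  sub := (basicIncl P.markov.state P.sub).range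
  tr := markovExt P.markov
  markov := markovExt_isMarkovTrace P.markov

/-- The Jones tower of `P = (N ⊆ M)`: the `n`-th term is `M_{n-1} ⊆ M_n`, with `M₀ = M` and
`M₋₁ = N`. -/
def tower (P : MarkovInclusion.{u} τ) : ℕ → MarkovInclusion.{u} τ
  | 0 => P
  | n + 1 => (tower P n).next

variable (P : MarkovInclusion.{u} τ)

/-- The inclusion `M_n ⊆ M_{n+1}`. -/
def towerIncl (n : ℕ) : (tower P n).Alg →⋆ₐ[ℂ] (tower P (n + 1)).Alg :=
  basicIncl (tower P n).markov.state (tower P n).sub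

/-- The Jones projection `e_{n+1} ∈ M_{n+1}`, implementing the conditional expectation of `M_n` onto
`M_{n-1}`. -/
def towerProj (n : ℕ) : (tower P (n + 1)).Alg :=
  basicProj (tower P n).markov.state (tower P n).sub

/-- The inclusion `M_m ⊆ M_n` for `m ≤ n`. -/
def towerMap (m n : ℕ) (hmn : m ≤ n) : (tower P m).Alg →⋆ₐ[ℂ] (tower P n).Alg :=
  Nat.leRec (motive := fun n _ => (tower P m).Alg →⋆ₐ[ℂ] (tower P n).Alg)
    (StarAlgHom.id ℂ _) (fun k _ f => (towerIncl P k).comp f) hmn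

lemma towerMap_self (n : ℕ) (x : (tower P n).Alg) : towerMap P n n le_rfl x = x := by
  rw [towerMap, Nat.leRec_self]
  rfl

lemma towerMap_succ (m n : ℕ) (hmn : m ≤ n) (x : (tower P m).Alg) :
    towerMap P m (n + 1) (Nat.le_succ_of_le hmn) x = towerIncl P n (towerMap P m n hmn x) := by
  rw [towerMap, Nat.leRec_succ _ _ hmn]
  rfl

instance : DirectedSystem (fun n => (tower P n).Alg) fun m n hmn => towerMap P m n hmn where
  map_self := towerMap_self P
  map_map := by
    intro k j i hij hjk x
    induction hjk with
    | refl => exact towerMap_self P j _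
    | step hjk ih =>
      exact (towerMap_succ P j _ hjk _).trans
        ((congrArg _ ih).trans (towerMap_succ P i _ (hij.trans hjk) x).symm)

/-- The star algebra `M_∞ = ⋃ M_n`. -/
abbrev TowerUnion : Type u := DirectLimit (fun n => (tower P n).Alg) (towerMap P)

/-- The inclusion `M_n ⊆ M_∞`. -/
def unionIncl (n : ℕ) : (tower P n).Alg →⋆ₐ[ℂ] TowerUnion P where
  toFun x := ⟦⟨n, x⟩⟧
  map_one' := (DirectLimit.one_def (f := towerMap P) n).symm
  map_mul' x y := (DirectLimit.mul_def (f := towerMap P) n x y).symm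
  map_zero' := (DirectLimit.zero_def (f := towerMap P) n).symm
  map_add' x y := (DirectLimit.add_def (f := towerMap P) n x y).symm
  commutes' r := (DirectLimit.algebraMap_def (f := towerMap P) n r).symm
  map_star' x := (DirectLimit.star_def (f := towerMap P) n x).symm

lemma tr_towerMap (m n : ℕ) (hmn : m ≤ n) (x : (tower P m).Alg) :
    (tower P n).tr (towerMap P m n hmn x) = (tower P m).tr x := by
  induction hmn with
  | refl => rw [towerMap_self]
  | step hmn ih =>
    rw [towerMap_succ, ← ih]
    exact markovExt_incl (tower P _).markov _

/-- The trace of `M_∞`, which restricts to the Markov trace of each `M_n`. -/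
def unionTr : TowerUnion P →ₗ[ℂ] ℂ :=
  DirectLimit.Module.lift ℂ ℕ (fun n => (tower P n).Alg) (towerMap P)
    (fun n => (tower P n).tr) fun m n hmn x => tr_towerMap P m n hmn x

lemma unionTr_incl (n : ℕ) (x : (tower P n).Alg) :
    unionTr P (unionIncl P n x) = (tower P n).tr x := rfl

lemma unionTr_state : IsFaithfulTracialState (unionTr P) where
  map_one := by
    rw [← map_one (unionIncl P 0), unionTr_incl, (tower P 0).markov.state.map_one]
  tracial a b := by
    induction a, b using DirectLimit.induction₂ with
    | ih n a b =>
      change unionTr P (unionIncl P n a * unionIncl P n b) =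
        unionTr P (unionIncl P n b * unionIncl P n a)
      rw [← map_mul, ← map_mul, unionTr_incl, unionTr_incl, (tower P n).markov.state.tracial]
  pos a ha := by
    induction a using DirectLimit.induction with
    | ih n a =>
      change 0 < unionTr P (star (unionIncl P n a) * unionIncl P n a)
      rw [← map_star, ← map_mul, unionTr_incl]
      refine (tower P n).markov.state.pos a fun h0 => ha ?_
      rw [h0]
      exact map_zero (unionIncl P n)

/-- Multiplication by an element of `M_n` has the same bound on every `L²(M_m)` with `m ≥ n`. -/
lemma towerMap_bound (m n : ℕ) (hmn : m ≤ n) (a : (tower P m).Alg) {C : ℝ}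
    (hC : ∀ x, (tower P m).tr (star (a * x) * (a * x)) ≤ C * (tower P m).tr (star x * x))
    (x : (tower P n).Alg) :
    (tower P n).tr (star (towerMap P m n hmn a * x) * (towerMap P m n hmn a * x)) ≤
      C * (tower P n).tr (star x * x) := by
  induction hmn with
  | refl =>
    rw [towerMap_self]
    exact hC x
  | @step n hmn ih =>
    rw [towerMap_succ]
    exact markovExt_bound (tower P n).markov _ ih x

lemma exists_bound (a : TowerUnion P) : ∃ C : ℝ, 0 ≤ C ∧ ∀ x,
    unionTr P (star (a * x) * (a * x)) ≤ C * unionTr P (star x * x) := by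
  induction a using DirectLimit.induction with
  | ih m a =>
    let h := (tower P m).markov.state
    refine ⟨‖leftMul h a‖ ^ 2, by positivity, fun x => ?_⟩
    have hC : ∀ x, (tower P m).tr (star (a * x) * (a * x)) ≤
        ((‖leftMul h a‖ ^ 2 : ℝ) : ℂ) * (tower P m).tr (star x * x) := by
      intro x
      rw [← inner_toL2 h, ← inner_toL2 h, inner_self_eq_norm_sq_to_K, inner_self_eq_norm_sq_to_K]
      have := (leftMul h a).le_opNorm (toL2 h x)
      rw [leftMul_toL2] at this
      have h2 := pow_le_pow_left₀ (norm_nonneg _) this 2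
      rw [mul_pow] at h2
      have h3 := Complex.real_le_real.2 h2
      push_cast at h3 ⊢
      exact h3
    induction x using DirectLimit.induction with
    | ih k x =>
      have h1 : (⟦⟨m, a⟩⟧ : TowerUnion P) =
          unionIncl P (max m k) (towerMap P m (max m k) (le_max_left _ _) a) :=
        (DirectLimit.mk_apply (f := towerMap P) _ _ _ _).symm
      have h2 : (⟦⟨k, x⟩⟧ : TowerUnion P) =
          unionIncl P (max m k) (towerMap P k (max m k) (le_max_right _ _) x) :=
        (DirectLimit.mk_apply (f := towerMap P) _ _ _ _).symm
      rw [h1, h2]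
      simp only [← map_mul (unionIncl P (max m k)), ← map_star (unionIncl P (max m k)),
        unionTr_incl]
      exact towerMap_bound P m _ (le_max_left _ _) a hC _

/-- Left multiplication by `a ∈ M_∞` as a bounded operator on `M_∞` with the inner product of the
trace. -/
def preRep (a : TowerUnion P) : L2 (unionTr_state P) →L[ℂ] L2 (unionTr_state P) :=
  LinearMap.mkContinuousOfExistsBound
    ((toL2 (unionTr_state P)).toLinearMap ∘ₗ LinearMap.mulLeft ℂ a ∘ₗ
      (toL2 (unionTr_state P)).symm.toLinearMap) <| by
    obtain ⟨C, hC0, hC⟩ := exists_bound P a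
    refine ⟨√C, fun x => ?_⟩
    obtain ⟨x, rfl⟩ := (toL2 (unionTr_state P)).surjective x
    have h1 := hC x
    rw [← inner_toL2 (unionTr_state P), ← inner_toL2 (unionTr_state P),
      inner_self_eq_norm_sq_to_K, inner_self_eq_norm_sq_to_K] at h1
    have h2 : ‖toL2 (unionTr_state P) (a * x)‖ ^ 2 ≤ C * ‖toL2 (unionTr_state P) x‖ ^ 2 := by
      refine Complex.real_le_real.1 ?_
      push_cast
      exact h1
    refine le_of_sq_le_sq ?_ (by positivity)
    rw [mul_pow, Real.sq_sqrt hC0]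
    exact h2

lemma preRep_toL2 (a b : TowerUnion P) :
    preRep P a (toL2 (unionTr_state P) b) = toL2 (unionTr_state P) (a * b) := rfl

/-- The Hilbert space `L²(M_∞, tr)`. -/
abbrev TowerL2 : Type u := UniformSpace.Completion (L2 (unionTr_state P))

lemma completion_ext {S T : TowerL2 P →L[ℂ] TowerL2 P}
    (hST : ∀ b : TowerUnion P, S (toL2 (unionTr_state P) b) = T (toL2 (unionTr_state P) b)) :
    S = T := by
  ext x
  induction x using UniformSpace.Completion.induction_on with
  | hp => apply isClosed_eq <;> fun_prop
  | ih x => exact hST ((toL2 (unionTr_state P)).symm x)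

/-- The GNS representation of `M_∞` on `L²(M_∞, tr)`. -/
def gnsRep : TowerUnion P →⋆ₐ[ℂ] (TowerL2 P →L[ℂ] TowerL2 P) where
  toFun a := (preRep P a).completion
  map_one' := completion_ext P fun b => by simp [preRep_toL2]
  map_mul' a b := completion_ext P fun c => by simp [preRep_toL2, mul_assoc]
  map_zero' := completion_ext P fun b => by simp [preRep_toL2]
  map_add' a b := completion_ext P fun c => by
    simp [preRep_toL2, add_mul, UniformSpace.Completion.coe_add]
  commutes' r := completion_ext P fun b => by
    simp [preRep_toL2, Algebra.algebraMap_eq_smul_one, UniformSpace.Completion.coe_smul]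
  map_star' a := by
    refine (ContinuousLinearMap.eq_adjoint_iff _ _).2 fun x y => ?_
    induction x, y using UniformSpace.Completion.induction_on₂ with
    | hp => apply isClosed_eq <;> fun_prop
    | ih x y =>
      obtain ⟨x, rfl⟩ := (toL2 (unionTr_state P)).surjective x
      obtain ⟨y, rfl⟩ := (toL2 (unionTr_state P)).surjective y
      simp [preRep_toL2, inner_toL2, mul_assoc]

/-- The von Neumann algebra `R` generated by the tower: the weak closure (double commutant) of
`M_∞` acting on `L²(M_∞, tr)`. -/
def factorR : VonNeumannAlgebra (TowerL2 P) :=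
  VonNeumannAlgebra.commutant
    { toStarSubalgebra := StarSubalgebra.centralizer ℂ (Set.range (gnsRep P))
      centralizer_centralizer' := by simp }

/-- The underlying star algebra of `R`. -/
abbrev FactorR : StarSubalgebra ℂ (TowerL2 P →L[ℂ] TowerL2 P) := (factorR P).toStarSubalgebra

lemma gnsRep_mem (a : TowerUnion P) : gnsRep P a ∈ FactorR P := by
  change gnsRep P a ∈ factorR P
  rw [factorR, VonNeumannAlgebra.mem_commutant_iff]
  intro g hg
  exact ((StarSubalgebra.mem_centralizer_iff ℂ).1 hg _ ⟨a, rfl⟩).1.symm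

/-- The inclusion `M_n ⊆ R`. -/
def toR (n : ℕ) : (tower P n).Alg →⋆ₐ[ℂ] FactorR P :=
  ((gnsRep P).comp (unionIncl P n)).codRestrict _ fun x => gnsRep_mem P (unionIncl P n x)

/-- The trace of `R`: the vector state of the class `Ω` of `1 ∈ M_∞` in `L²(M_∞, tr)`. -/
def trR (x : FactorR P) : ℂ :=
  ⟪(toL2 (unionTr_state P) 1 : TowerL2 P), x.1 (toL2 (unionTr_state P) 1 : TowerL2 P)⟫_ℂ

/-- `α` is an automorphism of `R` that extends the automorphism `α₀` of `M`, fixes all the Jones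
projections `e₁, e₂, …` and leaves every `M_n` invariant. -/
structure IsCompatibleExtension (α₀ : P.Alg ≃⋆ₐ[ℂ] P.Alg) (α : FactorR P ≃⋆ₐ[ℂ] FactorR P) :
    Prop where
  extends_base : ∀ x : P.Alg, α (toR P 0 x) = toR P 0 (α₀ x)
  fixes_proj : ∀ n, α (toR P (n + 1) (towerProj P n)) = toR P (n + 1) (towerProj P n)
  map_level : ∀ n, α '' Set.range (toR P n) = Set.range (toR P n)

end Tower

/-- An inclusion `N ⊆ M` is connected if the intersection of the centres of `N` and `M` (that is,
the set of elements of `N` that are central in `M`) consists of the scalars. -/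
def IsConnectedInclusion {M : Type u} [Ring M] [StarRing M] [Algebra ℂ M] [StarModule ℂ M]
    (N : StarSubalgebra ℂ M) : Prop :=
  ∀ z ∈ N, (∀ x : M, z * x = x * z) → ∃ c : ℂ, z = algebraMap ℂ M c

end JonesTower

end

/-! Existence. Any two Markov traces `tr`, `tr'` of the same modulus on a connected inclusion agree.
Write `tr' = tr (k ·)` with `k` central and self-adjoint. For a quasi-basis `g` the averaging map `x
↦ τ ∑ gᵢ E(x) gᵢ*` is positive and unital, and it fixes `k` (`density_harmonic`). By a maximum
principle the spectral projection of `k` at its largest spectral value lies in `N`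
(`mem_of_harmonic`). It is also central in `M`, so connectedness makes it `1` and `k` is a scalar,
equal to `1` by normalisation. Since `tr ∘ α₀` is again a Markov trace of modulus `τ`, it equals
`tr`. This is the only place where connectedness is used.

A trace-preserving automorphism that preserves the subalgebra is implemented by a unitary of `L²`
commuting with the Jones projection. Conjugation by it extends the automorphism to the basic
construction, fixes the projection and preserves the Markov extension of the trace, so the process
iterates up the tower. In the limit it gives a trace-preserving automorphism of `M_∞`, implemented
by a unitary of `L²(M_∞)` that fixes `Ω`. Conjugation by this unitary preserves the double commutant
`R`, and the trace since `Ω` is fixed.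

Uniqueness. `M_{n+1}` is spanned by `M_n e_{n+1} M_n`, so two compatible extensions agree on every
`M_n`, and `γ = β ∘ α⁻¹` fixes `M_∞` pointwise. No continuity of `γ` is assumed, so normality has to
be derived: `γ` is an order isomorphism and hence preserves suprema of bounded increasing sequences.
Each `x ∈ R` has approximants `aₙ ∈ M_n` with `‖aₙ‖ ≤ ‖x‖` and `aₙΩ → xΩ`; normality gives `aₙΩ →
γ(x)Ω` along a subsequence, and `Ω` is separating, so `γ(x) = x`. -/

noncomputable section

namespace JonesTower

universe u

set_option linter.unusedSectionVars false

/-! ### Quasi-bases and transport of Markov traces by automorphisms -/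

section Transport

variable {A : Type u} [Ring A] [StarRing A] [Algebra ℂ A] [StarModule ℂ A]
  [FiniteDimensional ℂ A] {N : StarSubalgebra ℂ A} {τ : ℝ}

lemma eq_of_tr_mul {tr : A →ₗ[ℂ] ℂ} (h : IsFaithfulTracialState tr) {a b : A}
    (hab : ∀ c, tr (a * c) = tr (b * c)) : a = b :=
  ext_tr h fun c => by rw [h.tracial, hab, h.tracial]

lemma sum_condExp_mul {tr : A →ₗ[ℂ] ℂ} (h : IsFaithfulTracialState tr) {n : ℕ} {g : Fin n → A}
    (hg : ∀ a, ∑ i, g i * condExp h N (star (g i) * a) = a) (a : A) :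
    ∑ i, condExp h N (a * g i) * star (g i) = a := by
  have := congrArg star (hg (star a))
  simpa [star_sum, ← condExp_star] using this

lemma tr_condExp {tr : A →ₗ[ℂ] ℂ} (h : IsFaithfulTracialState tr) (a : A) :
    tr (condExp h N a) = tr a := by
  simpa using tr_mul_condExp h N a (one_mem N)

/-- The index formula: a quasi-basis of an inclusion with Markov trace of modulus `τ` satisfies
`τ ∑ gᵢ gᵢ* = 1`. -/
lemma modulus_smul_sum_mul_star {tr : A →ₗ[ℂ] ℂ} (hm : IsMarkovTrace N tr τ) {n : ℕ}
    {g : Fin n → A} (hg : ∀ a, ∑ i, g i * condExp hm.state N (star (g i) * a) = a) :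
    (τ : ℂ) • ∑ i, g i * star (g i) = 1 := by
  refine ext_tr hm.state fun c => ?_
  -- The Markov extension at left multiplication by `c*` is computed twice: by restriction it is `tr
  -- (c*)`, by the quasi-basis formula it is `τ ∑ tr (gᵢ* c* gᵢ)`.
  have h1 := markovExt_eq hm hg (basicIncl hm.state N (star c))
  rw [markovExt_incl] at h1
  rw [mul_one, h1, mul_smul_comm, map_smul, smul_eq_mul, Finset.mul_sum, map_sum]
  congr 1
  refine Finset.sum_congr rfl fun i _ => ?_
  rw [act_incl, hm.state.tracial (star (g i)), mul_assoc]

lemma isFaithfulTracialState_comp {tr : A →ₗ[ℂ] ℂ} (h : IsFaithfulTracialState tr)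
    (θ : A ≃⋆ₐ[ℂ] A) {tr' : A →ₗ[ℂ] ℂ} (hθ : ∀ a, tr' a = tr (θ a)) :
    IsFaithfulTracialState tr' where
  map_one := by rw [hθ, map_one, h.map_one]
  tracial a b := by rw [hθ, hθ, map_mul θ, map_mul θ, h.tracial]
  pos a ha := by
    rw [hθ, map_mul θ, map_star θ]
    exact h.pos _ (by simpa using ha)

lemma condExp_map {tr tr' : A →ₗ[ℂ] ℂ} (h : IsFaithfulTracialState tr)
    (h' : IsFaithfulTracialState tr') (θ : A ≃⋆ₐ[ℂ] A) (hθ : ∀ a, tr' a = tr (θ a))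
    (hN : θ '' (N : Set A) = N) (a : A) :
    condExp h N (θ a) = θ (condExp h' N a) := by
  refine condExp_eq h ?_ fun b hb => ?_
  · rw [← SetLike.mem_coe, ← hN]
    exact ⟨_, condExp_mem h' N a, rfl⟩
  · rw [← SetLike.mem_coe, ← hN] at hb
    obtain ⟨b, hb, rfl⟩ := hb
    rw [← map_mul, ← map_mul, ← hθ, ← hθ, tr_mul_condExp h' N a hb]

/-- The elements `θ⁻¹(gᵢ)` form a quasi-basis for the transported trace. Rescaled by `√τ` they meet
the criterion `isMarkovTrace_of_basis`, whose normalisation `∑ dᵢ dᵢ* = 1` is the index formula. -/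
lemma isMarkovTrace_comp {tr tr' : A →ₗ[ℂ] ℂ} (hm : IsMarkovTrace N tr τ)
    (θ : A ≃⋆ₐ[ℂ] A) (hθ : ∀ a, tr' a = tr (θ a)) (hN : θ '' (N : Set A) = N) :
    IsMarkovTrace N tr' τ := by
  have h' := isFaithfulTracialState_comp hm.state θ hθ
  obtain ⟨n, g, hg⟩ := exists_basis hm.state N
  have hτ := modulus_pos hm
  have hs : ((√τ : ℝ) : ℂ) * ((√τ : ℝ) : ℂ) = τ := by
    rw [← Complex.ofReal_mul, Real.mul_self_sqrt hτ.le]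
  refine isMarkovTrace_of_basis h' N (Complex.ofReal_ne_zero.2 hτ.ne')
    (fun i => ((√τ : ℝ) : ℂ) • θ.symm (g i)) ?_ fun x => ?_
  · have h1 := congrArg θ.symm (modulus_smul_sum_mul_star hm hg)
    rw [map_one, map_smul, map_sum, Finset.smul_sum] at h1
    rw [← h1]
    refine Finset.sum_congr rfl fun i _ => ?_
    rw [star_smul, smul_mul_smul_comm, Complex.star_def, Complex.conj_ofReal, hs, map_mul, map_star]
  · apply θ.injective
    have h1 : θ ((τ : ℂ) • x) = (τ : ℂ) • θ x := map_smul θ _ _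
    refine Eq.trans (map_sum θ _ _) (Eq.trans ?_ h1.symm)
    conv_rhs => rw [← hg (θ x), Finset.smul_sum]
    refine Finset.sum_congr rfl fun i _ => ?_
    have h2 : ∀ (r : ℂ) (y : A), θ (r • y) = r • θ y := fun r y => map_smul θ r y
    rw [star_smul, smul_mul_assoc, smul_mul_assoc, Complex.star_def, Complex.conj_ofReal,
      (condExp h' N).map_smul, mul_smul_comm, smul_smul, hs, h2,
      map_mul, ← condExp_map hm.state h' θ hθ hN, map_mul, map_star, StarAlgEquiv.apply_symm_apply]

end Transport

/-! ### Harmonic densities and the maximum principle -/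

section Uniqueness

variable {A : Type u} [Ring A] [StarRing A] [Algebra ℂ A] [StarModule ℂ A]
  [FiniteDimensional ℂ A] {N : StarSubalgebra ℂ A} {τ : ℝ} {tr tr' : A →ₗ[ℂ] ℂ}

/-- A tracial state has a central self-adjoint density with respect to a faithful one. -/
lemma exists_density (h : IsFaithfulTracialState tr) (h' : IsFaithfulTracialState tr') :
    ∃ k : A, (∀ x, tr' x = tr (k * x)) ∧ star k = k ∧ ∀ x, k * x = x * k := by
  -- Faithfulness makes the form `tr (k x)` nondegenerate, so in finite dimension every functional
  -- is of the form `tr (k ·)`.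
  let T : A →ₗ[ℂ] Module.Dual ℂ A := (LinearMap.mul ℂ A).compr₂ tr
  have hT : ∀ k x, T k x = tr (k * x) := fun k x => rfl
  have hinj : Function.Injective T := fun a b hab =>
    eq_of_tr_mul h fun c => by rw [← hT, ← hT, hab]
  obtain ⟨k, hk⟩ := (LinearMap.injective_iff_surjective_of_finrank_eq_finrank
    (Subspace.dual_finrank_eq (K := ℂ) (V := A)).symm).1 hinj tr'
  have hk' : ∀ x, tr' x = tr (k * x) := fun x => by rw [← hT, hk]
  refine ⟨k, hk', eq_of_tr_mul h fun x => ?_, fun x => eq_of_tr_mul h fun y => ?_⟩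
  · rw [← star_star (star k * x), h.map_star, star_mul, star_star, h.tracial, ← hk', h'.map_star,
      star_star, hk']
  · rw [mul_assoc, ← hk', h'.tracial, hk', ← mul_assoc, h.tracial, ← mul_assoc, mul_assoc]

/-- The density of one Markov trace with respect to another one of the same modulus is harmonic. -/
lemma density_harmonic (hm : IsMarkovTrace N tr τ) (hm' : IsMarkovTrace N tr' τ) {k : A}
    (hk : ∀ x, tr' x = tr (k * x)) (hcomm : ∀ x, k * x = x * k) {n : ℕ} {g : Fin n → A}
    (hg : ∀ a, ∑ i, g i * condExp hm.state N (star (g i) * a) = a) :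
    (τ : ℂ) • ∑ i, g i * condExp hm.state N k * star (g i) = k := by
  obtain ⟨m, g', hg'⟩ := exists_basis hm'.state N
  -- Chain rule for the expectations `E`, `E'` of the two traces: `E(k) E'(x) = E(k x)`. Both sides
  -- lie in `N` and pair equally with `N` under `tr`.
  have hE : ∀ x, condExp hm.state N k * condExp hm'.state N x = condExp hm.state N (k * x) := by
    intro x
    refine (condExp_eq hm.state (mul_mem (condExp_mem _ N k) (condExp_mem _ N x))
      fun b hb => ?_).symm
    rw [← mul_assoc, hm.state.tracial, ← mul_assoc,
      tr_mul_condExp hm.state N k (mul_mem (condExp_mem _ N x) hb), ← hcomm, ← hk,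
      hm'.state.tracial, tr_mul_condExp hm'.state N x hb, hk, ← mul_assoc, ← mul_assoc, hcomm]
  -- Expand `gᵢ*` in the quasi-basis `g'` of `tr'`. The chain rule then turns `E'` into `E`, and the
  -- sum over `i` can be evaluated with the quasi-basis `g` of `tr`.
  have h1 : ∀ i, g i * condExp hm.state N k * star (g i) =
      ∑ j, g i * condExp hm.state N (star (g i) * (k * g' j)) * star (g' j) := by
    intro i
    conv_lhs => rw [← sum_condExp_mul hm'.state hg' (star (g i)), Finset.mul_sum]
    refine Finset.sum_congr rfl fun j _ => ?_
    rw [← mul_assoc, mul_assoc (g i), hE, ← mul_assoc, hcomm, mul_assoc (star (g i))]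
  simp_rw [h1]
  rw [Finset.sum_comm]
  simp_rw [← Finset.sum_mul, hg, mul_assoc, ← Finset.mul_sum]
  -- What remains is `k · τ ∑ g'ⱼ g'ⱼ*`; the index formula for `tr'` applies because the two moduli
  -- coincide.
  rw [← mul_smul_comm, modulus_smul_sum_mul_star hm' hg', mul_one]

lemma sum_eq_zero_of_tr (h : IsFaithfulTracialState tr) {ι : Type*} {s : Finset ι} {y : ι → A}
    (hy : ∑ i ∈ s, tr (star (y i) * y i) = 0) {i : ι} (hi : i ∈ s) : y i = 0 := by
  by_contra hne
  exact (h.pos _ hne).ne'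
    ((Finset.sum_eq_zero_iff_of_nonneg (fun i _ => h.nonneg (y i))).1 hy i hi)

/-- The maximum principle: if the harmonic central element `b²` vanishes on the central projection
`p`, which is its kernel, then `p` belongs to the subalgebra. -/
lemma mem_of_harmonic (hm : IsMarkovTrace N tr τ) {n : ℕ} {g : Fin n → A}
    (hg : ∀ a, ∑ i, g i * condExp hm.state N (star (g i) * a) = a) {b c p : A}
    (hb : star b = b) (hbc : ∀ x, b * x = x * b) (hp : star p = p) (hpc : ∀ x, p * x = x * p)
    (hpp : p * p = p) (hbp : b * p = 0) (hcb : 1 - p = c * b)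
    (hharm : (τ : ℂ) • ∑ i, g i * condExp hm.state N (b * b) * star (g i) = b * b) :
    p ∈ N := by
  have h := hm.state
  have hτ : (τ : ℂ) ≠ 0 := Complex.ofReal_ne_zero.2 (modulus_pos hm).ne'
  set E := condExp hm.state N with hE
  -- Writing `E(b²)` as a sum of squares `yⱼ* yⱼ` allows a vanishing trace to be split into
  -- vanishing terms.
  have hsq : E (b * b) = ∑ j, star (E (star (g j) * b)) * E (star (g j) * b) := by
    conv_lhs => rw [← hg b, Finset.mul_sum, map_sum]
    refine Finset.sum_congr rfl fun j _ => ?_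
    rw [← mul_assoc, hE, condExp_mul_right _ _ (condExp_mem _ N _), ← condExp_star, star_mul,
      star_star, hb, hg b]
  -- Multiplying the harmonic identity by `p` gives `∑ p gᵢ E(b²) gᵢ* p = 0`, since `b p = 0`. The
  -- trace is a sum of the nonnegative numbers `tr |yⱼ gᵢ* p|²`, so each `yⱼ gᵢ* p` vanishes.
  have h0 : ∀ i, E (b * b) * (star (g i) * p) = 0 := by
    intro i
    have h1 : ∑ i, ∑ j, tr (star (E (star (g j) * b) * (star (g i) * p)) *
        (E (star (g j) * b) * (star (g i) * p))) = 0 := by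
      have h2 : tr (p * ∑ i, g i * E (b * b) * star (g i)) = 0 := by
        have : ∑ i, g i * E (b * b) * star (g i) = (τ : ℂ)⁻¹ • (b * b) := by
          rw [eq_inv_smul_iff₀ hτ, hharm]
        rw [this, mul_smul_comm, ← mul_assoc, hpc, hbp, zero_mul, smul_zero, map_zero]
      rw [Finset.mul_sum, map_sum] at h2
      rw [← h2]
      refine Finset.sum_congr rfl fun i _ => ?_
      rw [hsq, Finset.mul_sum, Finset.sum_mul, Finset.mul_sum, map_sum]
      refine Finset.sum_congr rfl fun j _ => ?_
      rw [star_mul, star_mul, star_star, hp]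
      conv_rhs => rw [← hpp, mul_assoc, h.tracial]
      simp only [mul_assoc]
    rw [← Finset.sum_product'] at h1
    rw [hsq, Finset.sum_mul]
    refine Finset.sum_eq_zero fun j _ => ?_
    rw [mul_assoc, sum_eq_zero_of_tr h h1 (i := (i, j))
      (Finset.mem_product.2 ⟨Finset.mem_univ _, Finset.mem_univ _⟩), mul_zero]
  have hbb : ∀ x, b * b * x = x * (b * b) := fun x => by
    rw [mul_assoc, hbc, ← mul_assoc, hbc x, mul_assoc, hbc]
  -- Insert `1 = ∑ E(gᵢ) gᵢ*` and move `E(b²)`, which commutes with `N`, past `E(gᵢ)`.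
  have h1 : E (b * b) * p = 0 := by
    have hc : ∀ y ∈ N, E (b * b) * y = y * E (b * b) := by
      intro y hy
      rw [hE, ← condExp_mul_right _ _ hy, hbb, condExp_mul_left _ _ hy]
    conv_lhs => rw [← mul_one (E (b * b)), ← sum_condExp_mul hm.state hg 1, Finset.mul_sum,
      Finset.sum_mul]
    refine Finset.sum_eq_zero fun i _ => ?_
    rw [← mul_assoc, hc _ (condExp_mem _ N _), mul_assoc, mul_assoc, h0, mul_zero]
  have hEp : star (E p) = E p := by rw [hE, ← condExp_star, hp]
  -- `tr |b E(p)|² = tr (E(p)² E(b²))`, and `E(p) E(b²) = E(p E(b²)) = 0`.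
  have h2 : b * E p = 0 := by
    by_contra hne
    refine (h.pos _ hne).ne' ?_
    have h3 : E p * E (b * b) = 0 := by
      rw [hE, ← condExp_mul_right _ _ (condExp_mem _ N _), hpc, h1, map_zero]
    have h4 : star (b * E p) * (b * E p) = E p * (b * b) * E p := by
      rw [star_mul, hEp, hb]
      simp only [mul_assoc]
    rw [h4, h.tracial, ← mul_assoc, ← tr_mul_condExp h N (b * b)
      (mul_mem (condExp_mem _ N _) (condExp_mem _ N _)), mul_assoc, h3, mul_zero, map_zero]
  have h3 : p * E p = E p := by
    have : (1 - p) * E p = 0 := by rw [hcb, mul_assoc, h2, mul_zero]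
    rw [sub_mul, one_mul, sub_eq_zero] at this
    exact this.symm
  -- With `p E(p) = E(p)`, the number `tr ((p - E(p))²)` reduces to `tr p - tr E(p) = 0`.
  have h4 : p = E p := by
    by_contra hne
    refine (h.pos _ (sub_ne_zero.2 hne)).ne' ?_
    have h5 : tr (E p * E p) = tr (E p) := by
      rw [tr_mul_condExp h N p (condExp_mem _ N _), h.tracial, h3]
    rw [star_sub, hp, hEp, sub_mul, mul_sub, mul_sub, hpp, ← hpc, h3, map_sub, map_sub, map_sub,
      h5, hE, tr_condExp]
    ring
  rw [h4]
  exact condExp_mem _ N _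

end Uniqueness

/-! ### Uniqueness of the Markov trace of a connected inclusion -/

section Connected

variable {M : Type u} [CStarAlgebra M] [FiniteDimensional ℂ M]

/-- Spectral values are roots of the minimal polynomial. Finiteness makes every function continuous
on the spectrum, so the functional calculus may be used with indicator functions. -/
lemma finite_real_spectrum (k : M) : (spectrum ℝ k).Finite := by
  cases subsingleton_or_nontrivial M with
  | inl _ => simp [spectrum.of_subsingleton]
  | inr _ =>
    have : FiniteDimensional ℝ M := FiniteDimensional.complexToReal M
    have hk : IsIntegral ℝ k := Algebra.IsIntegral.isIntegral k
    refine ((minpoly ℝ k).rootSet_finite ℝ).subset fun t ht => ?_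
    rw [Polynomial.mem_rootSet]
    refine ⟨minpoly.ne_zero hk, ?_⟩
    have h1 := spectrum.subset_polynomial_aeval k (minpoly ℝ k) ⟨t, ht, rfl⟩
    rw [minpoly.aeval, spectrum.zero_eq] at h1
    simpa using h1

/-- The Markov trace of a given modulus of a connected inclusion is unique. -/
lemma markovTrace_unique {N : StarSubalgebra ℂ M} (hconn : IsConnectedInclusion N)
    {tr tr' : M →ₗ[ℂ] ℂ} {τ : ℝ} (hm : IsMarkovTrace N tr τ) (hm' : IsMarkovTrace N tr' τ) :
    tr' = tr := by
  obtain ⟨k, hk, hks, hkc⟩ := exists_density hm.state hm'.state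
  obtain ⟨n, g, hg⟩ := exists_basis hm.state N
  have hharm := density_harmonic hm hm' hk hkc hg
  have hsa : IsSelfAdjoint k := hks
  have : Nontrivial M := by
    refine ⟨1, 0, fun h => ?_⟩
    have := hm.state.map_one
    rw [h, map_zero] at this
    exact zero_ne_one this
  obtain ⟨l, hl, hmax⟩ := (finite_real_spectrum k).exists_maximalFor id _
    (ContinuousFunctionalCalculus.spectrum_nonempty (R := ℝ) k hsa)
  replace hmax : ∀ t ∈ spectrum ℝ k, t ≤ l := fun t ht => by
    by_contra hlt
    exact hlt (hmax ht (le_of_lt (not_le.1 hlt)))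
  have hcont : ∀ f : ℝ → ℝ, ContinuousOn f (spectrum ℝ k) :=
    fun f => (finite_real_spectrum k).continuousOn f
  have hcomm : ∀ (f : ℝ → ℝ) (x : M), cfc f k * x = x * cfc f k :=
    fun f x => Commute.cfc_real (hkc x) f
  have hsaf : ∀ f : ℝ → ℝ, star (cfc f k) = cfc f k := fun f =>
    (cfc_predicate (p := IsSelfAdjoint) f k).star_eq
  -- `b² = l - k` is positive because `l` is the largest spectral value. `p` is the spectral
  -- projection at `l`, hence the kernel projection of `b`, and `c` inverts `b` off that kernel (at
  -- `t = l` the inverse of `0` is `0`).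
  let b := cfc (fun t : ℝ => √(l - t)) k
  let p := cfc (fun t : ℝ => if t = l then (1 : ℝ) else 0) k
  let c := cfc (fun t : ℝ => (√(l - t))⁻¹) k
  have hbb : b * b = (l : ℂ) • 1 - k := by
    have h1 : cfc (fun t : ℝ => l - t) k = (l : ℂ) • 1 - k := by
      rw [cfc_sub _ _ k (hcont _) (hcont _), cfc_const l k, cfc_id' ℝ k,
        Algebra.algebraMap_eq_smul_one]
      rfl
    rw [← h1, ← cfc_mul _ _ k (hcont _) (hcont _)]
    exact cfc_congr fun t ht => Real.mul_self_sqrt (sub_nonneg.2 (hmax t ht))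
  have hp1 : p = 1 := by
    have hpN : p ∈ N := by
      refine mem_of_harmonic hm hg (b := b) (c := c) (hsaf _) (hcomm _) (hsaf _)
        (hcomm _) ?_ ?_ ?_ ?_
      · rw [← cfc_mul _ _ k (hcont _) (hcont _)]
        exact cfc_congr fun t ht => by simp
      · rw [← cfc_mul _ _ k (hcont _) (hcont _), ← cfc_zero ℝ k]
        refine cfc_congr fun t ht => ?_
        by_cases h : t = l <;> simp [h]
      · rw [← cfc_mul _ _ k (hcont _) (hcont _), ← cfc_one ℝ k, ← cfc_sub _ _ k (hcont _) (hcont _)]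
        refine cfc_congr fun t ht => ?_
        by_cases h : t = l
        · simp [h]
        · have : √(l - t) ≠ 0 := (Real.sqrt_pos.2 (sub_pos.2 (lt_of_le_of_ne (hmax t ht) h))).ne'
          simp [h, this]
      -- `l - k` is harmonic: `k` is, and so are the scalars by the index formula.
      · rw [hbb, map_sub, map_smul]
        have h1 : condExp hm.state N 1 = 1 := condExp_eq _ (one_mem N) fun _ _ => rfl
        simp_rw [h1, mul_sub, sub_mul, mul_smul_comm, smul_mul_assoc, mul_one]
        rw [Finset.sum_sub_distrib, smul_sub, hharm, ← Finset.smul_sum, smul_comm,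
          modulus_smul_sum_mul_star hm hg]
    obtain ⟨z, hz⟩ := hconn p hpN (hcomm _)
    have hpp : p * p = p := by
      rw [← cfc_mul _ _ k (hcont _) (hcont _)]
      exact cfc_congr fun t ht => by simp
    -- `l` is attained in the spectrum, so `1` is a spectral value of `p`.
    have hp0 : p ≠ 0 := by
      intro h0
      have h1 : (1 : ℝ) ∈ spectrum ℝ p := by
        rw [cfc_map_spectrum _ k hsa (hcont _)]
        exact ⟨l, hl, by simp⟩
      rw [h0, spectrum.zero_eq] at h1
      simp at h1
    rw [hz, ← map_mul] at hpp
    have h2 := (algebraMap ℂ M).injective hpp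
    have h3 : z ≠ 0 := by rintro rfl; exact hp0 (by rw [hz, map_zero])
    rw [hz, mul_left_cancel₀ h3 (h2.trans (mul_one z).symm), map_one]
  have hk1 : k = (l : ℂ) • 1 := by
    have h1 : b * p = 0 := by
      rw [← cfc_mul _ _ k (hcont _) (hcont _), ← cfc_zero ℝ k]
      refine cfc_congr fun t ht => ?_
      by_cases h : t = l <;> simp [h]
    rw [hp1, mul_one] at h1
    rw [h1, mul_zero] at hbb
    exact (sub_eq_zero.1 hbb.symm).symm
  have hl1 : (l : ℂ) = 1 := by
    have := hk 1
    rw [hm'.state.map_one, hk1, mul_one, map_smul, hm.state.map_one, smul_eq_mul, mul_one] at this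
    exact this.symm
  ext x
  rw [hk, hk1, hl1, one_smul, one_mul]

/-- An automorphism of a connected inclusion preserves the Markov trace. -/
lemma markovTrace_map {N : StarSubalgebra ℂ M} (hconn : IsConnectedInclusion N)
    {tr : M →ₗ[ℂ] ℂ} {τ : ℝ} (hm : IsMarkovTrace N tr τ) (θ : M ≃⋆ₐ[ℂ] M)
    (hN : θ '' (N : Set M) = N) (x : M) : tr (θ x) = tr x :=
  LinearMap.congr_fun (markovTrace_unique hconn hm (isMarkovTrace_comp hm θ
    (tr' := tr ∘ₗ (θ : M →⋆ₐ[ℂ] M).toAlgHom.toLinearMap) (fun _ => rfl) hN)) x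

end Connected

/-- The restriction of a star algebra automorphism to an invariant star subalgebra. -/
def restrictEquiv {B : Type*} [Ring B] [StarRing B] [Algebra ℂ B] [StarModule ℂ B]
    (S : StarSubalgebra ℂ B) (Φ : B ≃⋆ₐ[ℂ] B) (hΦ : ∀ x, Φ x ∈ S ↔ x ∈ S) : S ≃⋆ₐ[ℂ] S where
  toFun x := ⟨Φ x, (hΦ x).2 x.2⟩
  invFun x := ⟨Φ.symm x, (hΦ _).1 (by simp)⟩
  left_inv x := Subtype.ext (Φ.symm_apply_apply _)
  right_inv x := Subtype.ext (Φ.apply_symm_apply _)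
  map_mul' x y := Subtype.ext (map_mul Φ _ _)
  map_add' x y := Subtype.ext (map_add Φ _ _)
  map_star' x := Subtype.ext (map_star Φ _)
  map_smul' r x := Subtype.ext (map_smul Φ _ _)

lemma image_range_of_comm {X Y : Type*} {f : X → Y} {φ : Y → Y} {ψ : X → X}
    (hψ : Function.Surjective ψ) (hf : ∀ x, φ (f x) = f (ψ x)) :
    φ '' Set.range f = Set.range f := by
  rw [← Set.range_comp, ← hψ.range_comp f]
  exact congrArg Set.range (funext hf)

/-- If `g` commutes with all `sᵢ`, then so does `Φ⁻¹(g)`, because `Φ` sends `sᵢ` to another member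
of the family. Thus `Φ` preserves the double commutant of the family; `ψ` need not be bijective. -/
lemma commutes_map {B ι : Type*} [Ring B] [StarRing B] [Algebra ℂ B] (Φ : B ≃⋆ₐ[ℂ] B)
    {s : ι → B} {ψ : ι → ι} (hψ : ∀ i, Φ (s i) = s (ψ i)) {x : B}
    (hx : ∀ g, (∀ i, g * s i = s i * g) → g * x = x * g) {g : B}
    (hg : ∀ i, g * s i = s i * g) : g * Φ x = Φ x * g := by
  have h1 := congrArg Φ (hx (Φ.symm g) fun i => EquivLike.injective Φ (by
    rw [map_mul, map_mul, hψ, StarAlgEquiv.apply_symm_apply, hg]))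
  rwa [map_mul, map_mul, StarAlgEquiv.apply_symm_apply] at h1

/-! ### Unitary implementation and extension to the basic construction -/

section Implementation

variable {A : Type u} [Ring A] [StarRing A] [Algebra ℂ A] [StarModule ℂ A]
  {tr : A →ₗ[ℂ] ℂ} (h : IsFaithfulTracialState tr) (θ : A ≃⋆ₐ[ℂ] A) (hθ : ∀ a, tr (θ a) = tr a)

/-- The unitary operator on `L²(A, tr)` that implements a trace-preserving automorphism. -/
def l2Iso : L2 h ≃ₗᵢ[ℂ] L2 h :=
  LinearEquiv.isometryOfInner
    ((toL2 h).symm ≪≫ₗ { θ.toEquiv with map_add' := map_add θ, map_smul' := map_smul θ } ≪≫ₗ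
      toL2 h) fun x y => by
      obtain ⟨x, rfl⟩ := (toL2 h).surjective x
      obtain ⟨y, rfl⟩ := (toL2 h).surjective y
      change tr (star (θ x) * θ y) = tr (star x * y)
      rw [← map_star, ← map_mul, hθ]

lemma l2Iso_toL2 (a : A) : l2Iso h θ hθ (toL2 h a) = toL2 h (θ a) := rfl

lemma l2Iso_symm_toL2 (a : A) : (l2Iso h θ hθ).symm (toL2 h a) = toL2 h (θ.symm a) := rfl

lemma tr_symm_map {tr : A →ₗ[ℂ] ℂ} {θ : A ≃⋆ₐ[ℂ] A} (hθ : ∀ a, tr (θ a) = tr a) (a : A) :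
    tr (θ.symm a) = tr a := by
  rw [← hθ, StarAlgEquiv.apply_symm_apply]

variable [FiniteDimensional ℂ A] {N : StarSubalgebra ℂ A}

lemma image_symm {θ : A ≃⋆ₐ[ℂ] A} (hN : θ '' (N : Set A) = N) : θ.symm '' (N : Set A) = N := by
  conv_lhs => rw [← hN]
  rw [Set.image_image]
  simp

lemma act_conj (x : L2 h →L[ℂ] L2 h) (a : A) :
    act h ((l2Iso h θ hθ).conjStarAlgEquiv x) a = θ (act h x (θ.symm a)) := rfl

lemma conj_leftMul (a : A) :
    (l2Iso h θ hθ).conjStarAlgEquiv (leftMul h a) = leftMul h (θ a) := by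
  ext x
  obtain ⟨x, rfl⟩ := (toL2 h).surjective x
  rw [leftMul_toL2, LinearIsometryEquiv.conjStarAlgEquiv_apply_apply, l2Iso_symm_toL2,
    leftMul_toL2, l2Iso_toL2, map_mul, StarAlgEquiv.apply_symm_apply]

lemma conj_jonesProj (hN : θ '' (N : Set A) = N) :
    (l2Iso h θ hθ).conjStarAlgEquiv (jonesProj h N) = jonesProj h N := by
  ext x
  obtain ⟨x, rfl⟩ := (toL2 h).surjective x
  rw [LinearIsometryEquiv.conjStarAlgEquiv_apply_apply, l2Iso_symm_toL2,
    jonesProj_toL2, l2Iso_toL2, jonesProj_toL2, ← condExp_map h h θ (fun a => (hθ a).symm) hN,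
    StarAlgEquiv.apply_symm_apply]

lemma conj_mem_basicConstruction (hN : θ '' (N : Set A) = N) {x : L2 h →L[ℂ] L2 h}
    (hx : x ∈ basicConstruction h N) :
    (l2Iso h θ hθ).conjStarAlgEquiv x ∈ basicConstruction h N := by
  induction hx using StarAlgebra.adjoin_induction with
  | mem x hx =>
    rcases hx with ⟨a, rfl⟩ | rfl
    · rw [conj_leftMul]
      exact (basicIncl h N (θ a)).2
    · rw [conj_jonesProj h θ hθ hN]
      exact (basicProj h N).2
  | algebraMap r =>
    have h1 : (l2Iso h θ hθ).conjStarAlgEquiv (algebraMap ℂ _ r) = algebraMap ℂ _ r :=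
      (l2Iso h θ hθ).conjStarAlgEquiv.toAlgEquiv.commutes r
    rw [h1]
    exact algebraMap_mem _ r
  | add x y _ _ hx hy =>
    rw [map_add]
    exact add_mem hx hy
  | mul x y _ _ hx hy =>
    rw [map_mul]
    exact mul_mem hx hy
  | star x _ hx =>
    rw [map_star]
    exact star_mem hx

lemma conj_mem_basicConstruction_iff (hN : θ '' (N : Set A) = N) (x : L2 h →L[ℂ] L2 h) :
    (l2Iso h θ hθ).conjStarAlgEquiv x ∈ basicConstruction h N ↔ x ∈ basicConstruction h N := by
  refine ⟨fun hx => ?_, conj_mem_basicConstruction h θ hθ hN⟩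
  have := conj_mem_basicConstruction h θ.symm (tr_symm_map hθ) (image_symm hN) hx
  have h1 : (l2Iso h θ.symm (tr_symm_map hθ)).conjStarAlgEquiv
      ((l2Iso h θ hθ).conjStarAlgEquiv x) = x :=
    (l2Iso h θ hθ).conjStarAlgEquiv.symm_apply_apply x
  rwa [h1] at this

/-- The automorphism of the basic construction induced by a trace-preserving automorphism. -/
def basicAut (hN : θ '' (N : Set A) = N) : basicConstruction h N ≃⋆ₐ[ℂ] basicConstruction h N :=
  restrictEquiv _ (l2Iso h θ hθ).conjStarAlgEquiv (conj_mem_basicConstruction_iff h θ hθ hN)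

lemma basicAut_incl (hN : θ '' (N : Set A) = N) (a : A) :
    basicAut h θ hθ hN (basicIncl h N a) = basicIncl h N (θ a) :=
  Subtype.ext (conj_leftMul h θ hθ a)

lemma basicAut_proj (hN : θ '' (N : Set A) = N) :
    basicAut h θ hθ hN (basicProj h N) = basicProj h N :=
  Subtype.ext (conj_jonesProj h θ hθ hN)

/-- The formula `Tr x = τ ∑ tr (gᵢ* x gᵢ)` holds for every quasi-basis. Using `g` on one side and
`θ(g)` on the other gives the same sum, so connectedness of the next inclusion is not needed. -/
lemma markovExt_basicAut {τ : ℝ} (hm : IsMarkovTrace N tr τ) (hN : θ '' (N : Set A) = N)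
    (x : basicConstruction hm.state N) :
    markovExt hm (basicAut hm.state θ hθ hN x) = markovExt hm x := by
  obtain ⟨n, g, hg⟩ := exists_basis hm.state N
  have hg' : ∀ a, ∑ i, θ (g i) * condExp hm.state N (star (θ (g i)) * a) = a := by
    intro a
    obtain ⟨a, rfl⟩ := EquivLike.surjective θ a
    refine Eq.trans (Finset.sum_congr rfl fun i _ => ?_)
      ((map_sum θ _ _).symm.trans (congrArg θ (hg a)))
    rw [← map_star, ← map_mul, condExp_map hm.state hm.state θ (fun a => (hθ a).symm) hN,
      ← map_mul]
  rw [markovExt_eq hm hg x, markovExt_eq hm hg']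
  congr 1
  refine Finset.sum_congr rfl fun i _ => ?_
  have : act hm.state (basicAut hm.state θ hθ hN x).1 (θ (g i)) =
      θ (act hm.state x.1 (g i)) := by
    refine (act_conj hm.state θ hθ x.1 (θ (g i))).trans ?_
    rw [StarAlgEquiv.symm_apply_apply]
  rw [this, ← map_star, ← map_mul, hθ]

end Implementation

/-! ### The induced automorphisms of the tower, of `M_∞` and of `R` -/

section TowerAut

variable {τ : ℝ}

/-- A trace-preserving automorphism of an inclusion. -/
structure MarkovInclusion.Aut (P : MarkovInclusion.{u} τ) where
  toEquiv : P.Alg ≃⋆ₐ[ℂ] P.Alg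
  tr_map : ∀ a, P.tr (toEquiv a) = P.tr a
  image_sub : toEquiv '' (P.sub : Set P.Alg) = P.sub

/-- The induced automorphism of the basic construction. -/
def MarkovInclusion.Aut.next {P : MarkovInclusion.{u} τ} (σ : P.Aut) : P.next.Aut where
  toEquiv := basicAut P.markov.state σ.toEquiv σ.tr_map σ.image_sub
  tr_map := markovExt_basicAut σ.toEquiv σ.tr_map P.markov σ.image_sub
  image_sub := image_range_of_comm (EquivLike.surjective σ.toEquiv)
    (basicAut_incl P.markov.state σ.toEquiv σ.tr_map σ.image_sub)

variable {P : MarkovInclusion.{u} τ} (σ : P.Aut)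

/-- The induced automorphisms of the terms of the Jones tower. -/
def towerAut : ∀ n, (tower P n).Aut
  | 0 => σ
  | n + 1 => (towerAut n).next

lemma towerAut_incl (n : ℕ) (x : (tower P n).Alg) :
    towerIncl P n ((towerAut σ n).toEquiv x) = (towerAut σ (n + 1)).toEquiv (towerIncl P n x) :=
  (basicAut_incl _ _ _ (towerAut σ n).image_sub x).symm

lemma towerAut_proj (n : ℕ) :
    (towerAut σ (n + 1)).toEquiv (towerProj P n) = towerProj P n :=
  basicAut_proj _ _ _ (towerAut σ n).image_sub

lemma towerAut_map (m n : ℕ) (hmn : m ≤ n) (x : (tower P m).Alg) :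
    towerMap P m n hmn ((towerAut σ m).toEquiv x) =
      (towerAut σ n).toEquiv (towerMap P m n hmn x) := by
  induction hmn with
  | refl => rw [towerMap_self, towerMap_self]
  | step hmn ih => rw [towerMap_succ P m _ hmn, towerMap_succ P m _ hmn, ih, towerAut_incl]

lemma towerAut_symm_map (m n : ℕ) (hmn : m ≤ n) (x : (tower P m).Alg) :
    towerMap P m n hmn ((towerAut σ m).toEquiv.symm x) =
      (towerAut σ n).toEquiv.symm (towerMap P m n hmn x) := by
  refine EquivLike.injective (towerAut σ n).toEquiv ?_
  rw [← towerAut_map, StarAlgEquiv.apply_symm_apply, StarAlgEquiv.apply_symm_apply]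

/-- The induced automorphism of `M_∞`. -/
def unionAut : TowerUnion P ≃⋆ₐ[ℂ] TowerUnion P where
  toFun := DirectLimit.map _ _ (fun n => (towerAut σ n).toEquiv) (towerAut_map σ)
  invFun := DirectLimit.map _ _ (fun n => (towerAut σ n).toEquiv.symm) (towerAut_symm_map σ)
  left_inv a := by
    induction a using DirectLimit.induction with
    | ih n a => exact congrArg (unionIncl P n) ((towerAut σ n).toEquiv.symm_apply_apply a)
  right_inv a := by
    induction a using DirectLimit.induction with
    | ih n a => exact congrArg (unionIncl P n) ((towerAut σ n).toEquiv.apply_symm_apply a)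
  map_mul' a b := by
    induction a, b using DirectLimit.induction₂ with
    | ih n a b =>
      change DirectLimit.map _ _ _ _ (unionIncl P n a * unionIncl P n b) =
        unionIncl P n ((towerAut σ n).toEquiv a) * unionIncl P n ((towerAut σ n).toEquiv b)
      rw [← map_mul, ← map_mul, ← map_mul]
      rfl
  map_add' a b := by
    induction a, b using DirectLimit.induction₂ with
    | ih n a b =>
      change DirectLimit.map _ _ _ _ (unionIncl P n a + unionIncl P n b) =
        unionIncl P n ((towerAut σ n).toEquiv a) + unionIncl P n ((towerAut σ n).toEquiv b)
      rw [← map_add, ← map_add, ← map_add]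
      rfl
  map_star' a := by
    induction a using DirectLimit.induction with
    | ih n a =>
      change DirectLimit.map _ _ _ _ (star (unionIncl P n a)) =
        star (unionIncl P n ((towerAut σ n).toEquiv a))
      rw [← map_star, ← map_star, ← map_star]
      rfl
  map_smul' r a := by
    induction a using DirectLimit.induction with
    | ih n a =>
      change DirectLimit.map _ _ _ _ (r • unionIncl P n a) =
        r • unionIncl P n ((towerAut σ n).toEquiv a)
      have h1 : (towerAut σ n).toEquiv (r • a) = r • (towerAut σ n).toEquiv a := map_smul _ _ _
      rw [← map_smul, ← map_smul, ← h1]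
      rfl

lemma unionTr_unionAut (a : TowerUnion P) : unionTr P (unionAut σ a) = unionTr P a := by
  induction a using DirectLimit.induction with
  | ih n a => exact (towerAut σ n).tr_map a

/-- The unitary operator on `L²(M_∞, tr)` that implements the automorphism of `M_∞`. -/
def towerUnitary : TowerL2 P ≃ₗᵢ[ℂ] TowerL2 P :=
  (l2Iso (unionTr_state P) (unionAut σ) (unionTr_unionAut σ)).toLinearEquiv.extendOfIsometry
    (UniformSpace.Completion.toComplₗᵢ (𝕜 := ℂ)).toLinearMap
    (UniformSpace.Completion.toComplₗᵢ (𝕜 := ℂ)).toLinearMap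
    UniformSpace.Completion.denseRange_coe UniformSpace.Completion.denseRange_coe
    fun x => by
      change ‖((_ : L2 (unionTr_state P)) : TowerL2 P)‖ = ‖((_ : L2 (unionTr_state P)) : TowerL2 P)‖
      rw [UniformSpace.Completion.norm_coe, UniformSpace.Completion.norm_coe]
      exact LinearIsometryEquiv.norm_map _ x

lemma towerUnitary_coe (a : TowerUnion P) :
    towerUnitary σ (toL2 (unionTr_state P) a : TowerL2 P) =
      (toL2 (unionTr_state P) (unionAut σ a) : TowerL2 P) :=
  LinearEquiv.extendOfIsometry_eq _ _ _ _ _ _ _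

lemma towerUnitary_symm_coe (a : TowerUnion P) :
    (towerUnitary σ).symm (toL2 (unionTr_state P) a : TowerL2 P) =
      (toL2 (unionTr_state P) ((unionAut σ).symm a) : TowerL2 P) := by
  rw [LinearIsometryEquiv.symm_apply_eq, towerUnitary_coe, StarAlgEquiv.apply_symm_apply]

lemma gnsRep_coe (a b : TowerUnion P) :
    gnsRep P a (toL2 (unionTr_state P) b : TowerL2 P) =
      (toL2 (unionTr_state P) (a * b) : TowerL2 P) := by
  change (preRep P a).completion _ = _
  simp [preRep_toL2]

lemma conj_gnsRep (a : TowerUnion P) :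
    (towerUnitary σ).conjStarAlgEquiv (gnsRep P a) = gnsRep P (unionAut σ a) := by
  refine completion_ext P fun b => ?_
  rw [LinearIsometryEquiv.conjStarAlgEquiv_apply_apply, towerUnitary_symm_coe, gnsRep_coe,
    towerUnitary_coe, gnsRep_coe, map_mul, StarAlgEquiv.apply_symm_apply]

/-- The range of `gnsRep` is closed under adjoints, so commuting with it already implies commuting
with the adjoints that the star centralizer also requires. -/
lemma mem_factorR_iff {x : TowerL2 P →L[ℂ] TowerL2 P} :
    x ∈ FactorR P ↔ ∀ g, (∀ a, g * gnsRep P a = gnsRep P a * g) → g * x = x * g := by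
  change x ∈ factorR P ↔ _
  rw [factorR, VonNeumannAlgebra.mem_commutant_iff]
  refine forall_congr' fun g => imp_congr ?_ Iff.rfl
  change g ∈ StarSubalgebra.centralizer ℂ (Set.range (gnsRep P)) ↔ _
  rw [StarSubalgebra.mem_centralizer_iff]
  constructor
  · intro hg a
    exact (hg _ ⟨a, rfl⟩).1.symm
  · rintro hg _ ⟨a, rfl⟩
    exact ⟨(hg a).symm, by rw [← map_star, hg]⟩

lemma mem_factorR_of_conj (Φ : (TowerL2 P →L[ℂ] TowerL2 P) ≃⋆ₐ[ℂ] (TowerL2 P →L[ℂ] TowerL2 P))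
    (ψ : TowerUnion P → TowerUnion P) (hψ : ∀ a, Φ (gnsRep P a) = gnsRep P (ψ a))
    {x : TowerL2 P →L[ℂ] TowerL2 P} (hx : x ∈ FactorR P) : Φ x ∈ FactorR P := by
  exact mem_factorR_iff.2 fun g hg => commutes_map Φ hψ (mem_factorR_iff.1 hx) hg

lemma conj_mem_factorR_iff (x : TowerL2 P →L[ℂ] TowerL2 P) :
    (towerUnitary σ).conjStarAlgEquiv x ∈ FactorR P ↔ x ∈ FactorR P := by
  refine ⟨fun hx => ?_, mem_factorR_of_conj _ _ (conj_gnsRep σ)⟩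
  have := mem_factorR_of_conj (towerUnitary σ).conjStarAlgEquiv.symm (unionAut σ).symm
    (fun a => by
      refine EquivLike.injective (towerUnitary σ).conjStarAlgEquiv ?_
      rw [StarAlgEquiv.apply_symm_apply, conj_gnsRep, StarAlgEquiv.apply_symm_apply]) hx
  rwa [StarAlgEquiv.symm_apply_apply] at this

/-- The induced automorphism of `R`. -/
def factorAut : FactorR P ≃⋆ₐ[ℂ] FactorR P :=
  restrictEquiv _ (towerUnitary σ).conjStarAlgEquiv (conj_mem_factorR_iff σ)

lemma factorAut_toR (n : ℕ) (x : (tower P n).Alg) :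
    factorAut σ (toR P n x) = toR P n ((towerAut σ n).toEquiv x) :=
  Subtype.ext (conj_gnsRep σ (unionIncl P n x))

lemma factorAut_isCompatibleExtension : IsCompatibleExtension P σ.toEquiv (factorAut σ) where
  extends_base := factorAut_toR σ 0
  fixes_proj n := (factorAut_toR σ (n + 1) (towerProj P n)).trans
    (congrArg (toR P (n + 1)) (towerAut_proj σ n))
  map_level n := image_range_of_comm (EquivLike.surjective (towerAut σ n).toEquiv)
    (factorAut_toR σ n)

lemma trR_factorAut (x : FactorR P) : trR P (factorAut σ x) = trR P x := by
  have h1 : (towerUnitary σ).symm (toL2 (unionTr_state P) 1 : TowerL2 P) =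
      (toL2 (unionTr_state P) 1 : TowerL2 P) := by
    rw [towerUnitary_symm_coe, map_one]
  change ⟪(toL2 (unionTr_state P) 1 : TowerL2 P), towerUnitary σ (x.1
    ((towerUnitary σ).symm (toL2 (unionTr_state P) 1 : TowerL2 P)))⟫_ℂ = _
  rw [h1, ← LinearIsometryEquiv.inner_map_map (towerUnitary σ).symm,
    LinearIsometryEquiv.symm_apply_apply, h1]
  rfl

end TowerAut

/-! ### Normality of automorphisms of a von Neumann algebra -/

section Operators

open Filter Topology NNReal

variable {H : Type*} [NormedAddCommGroup H] [InnerProductSpace ℂ H] [CompleteSpace H]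

lemma re_inner_mono {x y : H →L[ℂ] H} (hxy : x ≤ y) (ξ : H) :
    (⟪x ξ, ξ⟫_ℂ).re ≤ (⟪y ξ, ξ⟫_ℂ).re := by
  have h1 := (Complex.nonneg_iff.1 (((ContinuousLinearMap.le_def x y).1 hxy).inner_nonneg_left ξ)).1
  rw [sub_apply, inner_sub_left, Complex.sub_re] at h1
  linarith

lemma nonneg_of_tendsto {T : ℕ → H →L[ℂ] H} {S : H →L[ℂ] H} (hT : ∀ n, 0 ≤ T n)
    (hlim : ∀ ξ, Tendsto (fun n => T n ξ) atTop (𝓝 (S ξ))) : 0 ≤ S := by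
  rw [ContinuousLinearMap.nonneg_iff_isPositive, ContinuousLinearMap.isPositive_iff_complex]
  intro ξ
  have h1 : 0 ≤ ⟪S ξ, ξ⟫_ℂ := by
    refine ge_of_tendsto' ((hlim ξ).inner tendsto_const_nhds) fun n => ?_
    exact ((ContinuousLinearMap.nonneg_iff_isPositive _).1 (hT n)).inner_nonneg_left ξ
  obtain ⟨h2, h3⟩ := Complex.nonneg_iff.1 h1
  exact ⟨Complex.ext rfl (by simpa using h3), h2⟩

/-- This is `d² ≤ d`, obtained by testing `d ≤ 1` on `√d ξ`. It turns convergence of quadratic forms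
into convergence in norm. -/
lemma norm_sq_le_re_inner {d : H →L[ℂ] H} (h0 : 0 ≤ d) (h1 : d ≤ 1) (ξ : H) :
    ‖d ξ‖ ^ 2 ≤ (⟪d ξ, ξ⟫_ℂ).re := by
  set s := CFC.sqrt d with hs
  have hss : s * s = d := CFC.sqrt_mul_sqrt_self d h0
  have hsa : star s = s := (IsSelfAdjoint.of_nonneg (CFC.sqrt_nonneg d)).star_eq
  have hin : ∀ η ζ, ⟪s η, ζ⟫_ℂ = ⟪η, s ζ⟫_ℂ := fun η ζ => by
    conv_lhs => rw [← hsa]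
    exact ContinuousLinearMap.adjoint_inner_left s ζ η
  have hd : ∀ η, d η = s (s η) := fun η => by rw [← hss]; rfl
  have h2 : (⟪d (s ξ), s ξ⟫_ℂ).re ≤ (⟪s ξ, s ξ⟫_ℂ).re := re_inner_mono h1 (s ξ)
  have h3 : ⟪d (s ξ), s ξ⟫_ℂ = ⟪d ξ, d ξ⟫_ℂ := by
    rw [hd (s ξ), hin, ← hd]
  rw [h3, hin (ξ), ← hd, inner_self_eq_norm_sq_to_K] at h2
  have h4 : ⟪ξ, d ξ⟫_ℂ = ⟪d ξ, ξ⟫_ℂ := by rw [hd, hin, hin]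
  rw [h4] at h2
  refine le_trans (le_of_eq ?_) h2
  norm_cast

/-- A bounded increasing sequence of operators converges strongly. -/
lemma exists_strong_limit {z : ℕ → H →L[ℂ] H} (hmono : Monotone z) (h0 : ∀ n, 0 ≤ z n)
    (h1 : ∀ n, z n ≤ 1) : ∃ w : H →L[ℂ] H, ∀ ξ, Tendsto (fun n => z n ξ) atTop (𝓝 (w ξ)) := by
  have hlim : ∀ ξ, ∃ η, Tendsto (fun n => z n ξ) atTop (𝓝 η) := by
    intro ξ
    refine cauchySeq_tendsto_of_complete (Metric.cauchySeq_iff'.2 fun ε hε => ?_)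
    have hm : Monotone fun n => (⟪z n ξ, ξ⟫_ℂ).re := fun m n hmn => re_inner_mono (hmono hmn) ξ
    have hb : BddAbove (Set.range fun n => (⟪z n ξ, ξ⟫_ℂ).re) :=
      ⟨_, by rintro _ ⟨n, rfl⟩; exact re_inner_mono (h1 n) ξ⟩
    obtain ⟨N, hN⟩ := Metric.cauchySeq_iff'.1 (tendsto_atTop_ciSup hm hb).cauchySeq (ε ^ 2)
      (by positivity)
    refine ⟨N, fun n hn => ?_⟩
    have h2 := norm_sq_le_re_inner (sub_nonneg.2 (hmono hn))
      ((sub_le_self _ (h0 N)).trans (h1 n)) ξ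
    rw [sub_apply, inner_sub_left, Complex.sub_re] at h2
    rw [dist_eq_norm]
    refine lt_of_pow_lt_pow_left₀ 2 hε.le (h2.trans_lt ?_)
    have := hN n hn
    rw [Real.dist_eq] at this
    exact (le_abs_self _).trans_lt this
  choose f hf using hlim
  exact ⟨continuousLinearMapOfTendsto z (tendsto_pi_nhds.2 hf), hf⟩

variable (S : VonNeumannAlgebra H)

lemma mem_iff_commutes {x : H →L[ℂ] H} : x ∈ S ↔ ∀ g ∈ S.commutant, g * x = x * g := by
  conv_lhs => rw [← S.commutant_commutant]
  exact VonNeumannAlgebra.mem_commutant_iff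

lemma mem_of_tendsto {T : ℕ → H →L[ℂ] H} {w : H →L[ℂ] H} (hT : ∀ n, T n ∈ S)
    (hlim : ∀ ξ, Tendsto (fun n => T n ξ) atTop (𝓝 (w ξ))) : w ∈ S := by
  rw [mem_iff_commutes]
  intro g hg
  ext ξ
  refine tendsto_nhds_unique ((g.continuous.tendsto _).comp (hlim ξ)) ?_
  refine (hlim (g ξ)).congr fun n => ?_
  exact congrArg (fun A : H →L[ℂ] H => A ξ) ((mem_iff_commutes S).1 (hT n) g hg).symm

lemma cfcₙ_mem {x : H →L[ℂ] H} (hx : x ∈ S) (f : ℝ≥0 → ℝ≥0) : cfcₙ f x ∈ S := by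
  rw [mem_iff_commutes]
  intro g hg
  have : Commute x g := ((mem_iff_commutes S).1 hx g hg).symm
  exact (this.cfcₙ_nnreal f).eq.symm

/-- The operator monotone function `x (1 + x)⁻¹`. -/
def squash (x : H →L[ℂ] H) : H →L[ℂ] H := cfcₙ (fun t : ℝ≥0 => 1 - (1 + t)⁻¹) x

lemma one_sub_one_add_inv (t : ℝ≥0) : 1 - (1 + t)⁻¹ = t / (1 + t) := by
  refine tsub_eq_of_eq_add ?_
  have : 1 + t ≠ 0 := (add_pos_of_pos_of_nonneg one_pos zero_le).ne'
  field_simp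
  ring

lemma continuous_squash : Continuous fun t : ℝ≥0 => 1 - (1 + t)⁻¹ :=
  continuous_const.sub ((continuous_const.add continuous_id).inv₀ fun _ =>
    (add_pos_of_pos_of_nonneg one_pos zero_le).ne')

lemma squash_eq_cfc (x : H →L[ℂ] H) : squash x = cfc (fun t : ℝ≥0 => 1 - (1 + t)⁻¹) x :=
  cfcₙ_eq_cfc (hf := continuous_squash.continuousOn) (hf0 := by simp)

lemma squash_nonneg (x : H →L[ℂ] H) : 0 ≤ squash x := cfcₙ_predicate _ x

lemma squash_le_one (x : H →L[ℂ] H) : squash x ≤ 1 := by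
  rw [squash_eq_cfc]
  exact cfc_le_one _ _ fun t _ => tsub_le_self

lemma squash_le {x : H →L[ℂ] H} (hx : 0 ≤ x) : squash x ≤ x := by
  rw [squash_eq_cfc]
  conv_rhs => rw [← cfc_id' ℝ≥0 x]
  refine cfc_mono (fun t _ => ?_) continuous_squash.continuousOn continuousOn_id
  rw [one_sub_one_add_inv]
  exact div_le_self zero_le le_self_add

/-- On `[0, 1]` one has `t ≤ 2t / (1 + t)`. So bounding `squash x` still controls `x`, while
`squash` keeps unbounded sums below `1` without destroying monotonicity. -/
lemma le_two_smul_squash {x : H →L[ℂ] H} (hx : 0 ≤ x) (hx1 : x ≤ 1) :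
    x ≤ squash x + squash x := by
  rw [squash_eq_cfc, ← cfc_add _ _ _ continuous_squash.continuousOn continuous_squash.continuousOn]
  conv_lhs => rw [← cfc_id' ℝ≥0 x]
  refine cfc_mono (fun t ht => ?_) continuousOn_id
    (continuous_squash.add continuous_squash).continuousOn
  have h1 : t ≤ 1 := (CStarAlgebra.le_nnnorm_of_mem_quasispectrum
    (spectrum_subset_quasispectrum ℝ≥0 x ht)).trans
      ((CStarAlgebra.nnnorm_le_one_iff_of_nonneg x hx).2 hx1)
  rw [one_sub_one_add_inv, ← add_div,
    le_div_iff₀ (add_pos_of_pos_of_nonneg one_pos zero_le), mul_add, mul_one]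
  gcongr
  exact mul_le_of_le_one_right zero_le h1

lemma squash_mono {x y : H →L[ℂ] H} (hx : 0 ≤ x) (hxy : x ≤ y) : squash x ≤ squash y :=
  CFC.monotoneOn_one_sub_one_add_inv hx (hx.trans hxy) hxy

variable {S} (γ : S.toStarSubalgebra ≃⋆ₐ[ℂ] S.toStarSubalgebra)

/-- Positive elements have their square roots in the algebra, so positivity is an algebraic
property. -/
lemma aut_nonneg {x : S.toStarSubalgebra} (hx : 0 ≤ x.1) : 0 ≤ (γ x).1 := by
  let s : S.toStarSubalgebra := ⟨CFC.sqrt x.1, cfcₙ_mem S x.2 _⟩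
  have hs : star s * s = x := by
    apply Subtype.ext
    change star (CFC.sqrt x.1) * CFC.sqrt x.1 = x.1
    rw [(IsSelfAdjoint.of_nonneg (CFC.sqrt_nonneg x.1)).star_eq, CFC.sqrt_mul_sqrt_self x.1 hx]
  rw [← hs, map_mul, map_star]
  exact star_mul_self_nonneg (γ s).1

lemma aut_mono {x y : S.toStarSubalgebra} (hxy : x.1 ≤ y.1) : (γ x).1 ≤ (γ y).1 := by
  rw [← sub_nonneg] at hxy ⊢
  have h1 := aut_nonneg γ (x := y - x) hxy
  rwa [map_sub] at h1

/-- Automorphisms are normal: they preserve increasing sequences with supremum `1`. -/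
lemma tendsto_aut_of_isLUB_one {u : ℕ → S.toStarSubalgebra} (hmono : Monotone fun n => (u n).1)
    (h0 : ∀ n, 0 ≤ (u n).1) (h1 : ∀ n, (u n).1 ≤ 1)
    (hsup : ∀ w : H →L[ℂ] H, (∀ n, (u n).1 ≤ w) → 1 ≤ w) (ξ : H) :
    Tendsto (fun n => (γ (u n)).1 ξ) atTop (𝓝 ξ) := by
  have hm' : Monotone fun n => (γ (u n)).1 := fun m n hmn => aut_mono γ (hmono hmn)
  have h1' : ∀ n, (γ (u n)).1 ≤ 1 := fun n => by
    have := aut_mono γ (x := u n) (y := 1) (h1 n)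
    rwa [map_one] at this
  obtain ⟨w, hw⟩ := exists_strong_limit hm' (fun n => aut_nonneg γ (h0 n)) h1'
  have hwS : w ∈ S := mem_of_tendsto S (fun n => (γ (u n)).2) hw
  have hle : ∀ n, (γ (u n)).1 ≤ w := fun n => by
    rw [← sub_nonneg]
    refine nonneg_of_tendsto (T := fun k => (γ (u (n + k))).1 - (γ (u n)).1)
      (fun k => sub_nonneg.2 (hm' (Nat.le_add_right n k))) fun ξ => ?_
    exact (((hw ξ).comp (tendsto_add_atTop_nat n)).congr fun k => by
      simp [add_comm]).sub_const ((γ (u n)).1 ξ)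
  have hw1 : w ≤ 1 := by
    rw [← sub_nonneg]
    exact nonneg_of_tendsto (T := fun k => 1 - (γ (u k)).1) (fun k => sub_nonneg.2 (h1' k))
      fun ξ => (hw ξ).const_sub ξ
  -- The strong limit `w` of `γ(uₙ)` stays in the algebra, so it can be pulled back; `γ⁻¹(w)`
  -- dominates every `uₙ`, hence dominates `1`.
  have h2 : 1 ≤ (γ.symm ⟨w, hwS⟩).1 := hsup _ fun n => by
    have := aut_mono γ.symm (x := γ (u n)) (y := ⟨w, hwS⟩) (hle n)
    rwa [StarAlgEquiv.symm_apply_apply] at this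
  have h3 := aut_mono γ (x := 1) (y := γ.symm ⟨w, hwS⟩) h2
  rw [map_one, StarAlgEquiv.apply_symm_apply] at h3
  have h4 : w = 1 := le_antisymm hw1 h3
  simpa [h4] using hw ξ

variable {Ω : H}

lemma eq_zero_of_re_inner (hsep : ∀ x ∈ S, x Ω = 0 → x = 0) {v : H →L[ℂ] H} (hv : v ∈ S)
    (h0 : 0 ≤ v) (h1 : v ≤ 1) (hΩ : (⟪v Ω, Ω⟫_ℂ).re ≤ 0) : v = 0 := by
  refine hsep v hv ?_
  have := (norm_sq_le_re_inner h0 h1 Ω).trans hΩ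
  exact norm_eq_zero.1 (pow_eq_zero_iff two_ne_zero |>.1 (le_antisymm this (by positivity)))

/-- Automorphisms are continuous with respect to the seminorms of a separating vector: a form of
normality. -/
lemma tendsto_re_inner_aut (hsep : ∀ x ∈ S, x Ω = 0 → x = 0) {y : ℕ → S.toStarSubalgebra}
    (h0 : ∀ n, 0 ≤ (y n).1) (h1 : ∀ n, (y n).1 ≤ 1)
    (hsum : Summable fun n => (⟪(y n).1 Ω, Ω⟫_ℂ).re) :
    Tendsto (fun n => (⟪(γ (y n)).1 Ω, Ω⟫_ℂ).re) atTop (𝓝 0) := by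
  -- The tail sums need not be bounded in norm, but their images under `squash` increase in `N` and
  -- stay below `1`. The strong limits `wₙ` decrease in `n`, satisfy `yₙ ≤ 2wₙ`, and have `⟨wₙΩ, Ω⟩`
  -- at most the tail of the convergent series.
  let s : ℕ → ℕ → H →L[ℂ] H := fun n N => ∑ k ∈ Finset.range N, (y (n + k)).1
  have hs0 : ∀ n N, 0 ≤ s n N := fun n N => Finset.sum_nonneg fun k _ => h0 _
  have hsS : ∀ n N, s n N ∈ S := fun n N => sum_mem fun k _ => (y (n + k)).2
  have hsm : ∀ n, Monotone (s n) := fun n => monotone_nat_of_le_succ fun N => by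
    simp only [s, Finset.sum_range_succ]
    exact le_add_of_nonneg_right (h0 _)
  have hz : ∀ n, Monotone fun N => squash (s n N) := fun n M N hMN =>
    squash_mono (hs0 n M) (hsm n hMN)
  choose w hw using fun n => exists_strong_limit (hz n) (fun N => squash_nonneg _)
    fun N => squash_le_one _
  have hwS : ∀ n, w n ∈ S := fun n => mem_of_tendsto S (fun N => cfcₙ_mem S (hsS n N) _) (hw n)
  have hle : ∀ n N, squash (s n N) ≤ w n := fun n N => by
    rw [← sub_nonneg]
    refine nonneg_of_tendsto (T := fun k => squash (s n (N + k)) - squash (s n N))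
      (fun k => sub_nonneg.2 (hz n (Nat.le_add_right N k))) fun ξ => ?_
    exact (((hw n ξ).comp (tendsto_add_atTop_nat N)).congr fun k => by
      simp [add_comm]).sub_const (squash (s n N) ξ)
  have hub : ∀ n (b : H →L[ℂ] H), (∀ N, squash (s n N) ≤ b) → w n ≤ b := fun n b hb => by
    rw [← sub_nonneg]
    exact nonneg_of_tendsto (T := fun k => b - squash (s n k)) (fun k => sub_nonneg.2 (hb k))
      fun ξ => (hw n ξ).const_sub (b ξ)
  have hw0 : ∀ n, 0 ≤ w n := fun n => (squash_nonneg _).trans (hle n 0)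
  have hw1 : ∀ n, w n ≤ 1 := fun n => hub n 1 fun N => squash_le_one _
  have hanti : Antitone w := antitone_nat_of_succ_le fun n => hub _ _ fun N => by
    refine (squash_mono (hs0 _ _) ?_).trans (hle n (N + 1))
    simp only [s, Finset.sum_range_succ']
    refine (Finset.sum_le_sum fun k _ => ?_).trans (le_add_of_nonneg_right (h0 _))
    rw [show n + 1 + k = n + (k + 1) by ring]
  have hyw : ∀ n, (y n).1 ≤ w n + w n := fun n => by
    have h2 : squash (y n).1 ≤ w n := by
      have := hle n 1
      simpa [s] using this
    exact (le_two_smul_squash (h0 n) (h1 n)).trans (add_le_add h2 h2)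
  have hwΩ : ∀ n, (⟪w n Ω, Ω⟫_ℂ).re ≤ ∑' k, (⟪(y (k + n)).1 Ω, Ω⟫_ℂ).re := fun n => by
    have hlim : Tendsto (fun N => (⟪squash (s n N) Ω, Ω⟫_ℂ).re) atTop (𝓝 (⟪w n Ω, Ω⟫_ℂ).re) :=
      (Complex.continuous_re.tendsto _).comp ((hw n Ω).inner tendsto_const_nhds)
    refine le_of_tendsto' hlim fun N => (re_inner_mono (squash_le (hs0 n N)) Ω).trans ?_
    have h2 : (⟪s n N Ω, Ω⟫_ℂ).re = ∑ k ∈ Finset.range N, (⟪(y (k + n)).1 Ω, Ω⟫_ℂ).re := by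
      simp only [s, sum_apply, sum_inner, Complex.re_sum, add_comm n]
    rw [h2]
    refine Summable.sum_le_tsum _ (fun k _ => ?_) ((_root_.summable_nat_add_iff n).2 hsum)
    simpa using re_inner_mono (h0 (k + n)) Ω
  have hwlim : Tendsto (fun n => ∑' k, (⟪(y (k + n)).1 Ω, Ω⟫_ℂ).re) atTop (𝓝 0) :=
    tendsto_sum_nat_add fun k => (⟪(y k).1 Ω, Ω⟫_ℂ).re
  let u : ℕ → S.toStarSubalgebra := fun n => 1 - ⟨w n, hwS n⟩
  have hu : ∀ n, (u n).1 = 1 - w n := fun n => rfl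
  have hum : Monotone fun n => (u n).1 := fun m n hmn => sub_le_sub_left (hanti hmn) 1
  have hu0 : ∀ n, 0 ≤ (u n).1 := fun n => sub_nonneg.2 (hw1 n)
  have hu1 : ∀ n, (u n).1 ≤ 1 := fun n => sub_le_self _ (hw0 n)
  -- The strong limit `c` of `uₙ = 1 - wₙ` satisfies `⟨(1 - c)Ω, Ω⟩ ≤ 0`; as `Ω` is separating, `c =
  -- 1`.
  have hsup : ∀ b : H →L[ℂ] H, (∀ n, (u n).1 ≤ b) → 1 ≤ b := by
    obtain ⟨c, hc⟩ := exists_strong_limit hum hu0 hu1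
    have hcS : c ∈ S := mem_of_tendsto S (fun n => (u n).2) hc
    have hc1 : c ≤ 1 := by
      rw [← sub_nonneg]
      exact nonneg_of_tendsto (T := fun k => 1 - (u k).1) (fun k => sub_nonneg.2 (hu1 k))
        fun ξ => (hc ξ).const_sub ξ
    have hc0 : 0 ≤ c := nonneg_of_tendsto hu0 hc
    have hcu : 1 - c = 0 := by
      refine eq_zero_of_re_inner hsep (sub_mem (one_mem S) hcS) (sub_nonneg.2 hc1)
        (sub_le_self _ hc0) ?_
      have h2 : Tendsto (fun n => (⟪w n Ω, Ω⟫_ℂ).re) atTop (𝓝 (⟪(1 - c) Ω, Ω⟫_ℂ).re) := by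
        refine (Complex.continuous_re.tendsto _).comp (Tendsto.inner ?_ tendsto_const_nhds)
        refine ((hc Ω).const_sub Ω).congr fun n => ?_
        simp [hu]
      exact le_of_tendsto_of_tendsto' h2 hwlim hwΩ
    intro b hb
    rw [sub_eq_zero.1 hcu, ← sub_nonneg]
    exact nonneg_of_tendsto (T := fun k => b - (u k).1) (fun k => sub_nonneg.2 (hb k))
      fun ξ => (hc ξ).const_sub (b ξ)
  have hγ := tendsto_aut_of_isLUB_one γ hum hu0 hu1 hsup Ω
  have hγw : Tendsto (fun n => 2 * (⟪(γ ⟨w n, hwS n⟩).1 Ω, Ω⟫_ℂ).re) atTop (𝓝 0) := by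
    have h2 : Tendsto (fun n => (γ ⟨w n, hwS n⟩).1 Ω) atTop (𝓝 0) := by
      have := hγ.const_sub Ω
      rw [sub_self] at this
      refine this.congr fun n => ?_
      have h3 : γ (u n) = 1 - γ ⟨w n, hwS n⟩ := by rw [map_sub, map_one]
      rw [h3]
      change Ω - (Ω - _) = _
      rw [sub_sub_cancel]
      rfl
    have h3 := ((Complex.continuous_re.tendsto _).comp
      (h2.inner (tendsto_const_nhds (x := Ω)))).const_mul 2
    simpa using h3
  refine squeeze_zero (fun n => ?_) (fun n => ?_) hγw
  · simpa using re_inner_mono (aut_nonneg γ (h0 n)) Ω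
  · have h2 := re_inner_mono (aut_mono γ (x := y n) (y := ⟨w n, hwS n⟩ + ⟨w n, hwS n⟩) (hyw n)) Ω
    rw [map_add] at h2
    refine h2.trans_eq ?_
    change (⟪(γ ⟨w n, hwS n⟩).1 Ω + (γ ⟨w n, hwS n⟩).1 Ω, Ω⟫_ℂ).re = _
    rw [inner_add_left, Complex.add_re, two_mul]

/-- An automorphism of a von Neumann algebra with a separating vector fixes the limits of bounded
sequences of fixed points. -/
lemma aut_eq_of_tendsto (hsep : ∀ x ∈ S, x Ω = 0 → x = 0) {x : S.toStarSubalgebra}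
    {a : ℕ → S.toStarSubalgebra} (hγ : ∀ n, γ (a n) = a n) {C : ℝ} (ha : ∀ n, ‖(a n).1‖ ≤ C)
    (hlim : Tendsto (fun n => (a n).1 Ω) atTop (𝓝 (x.1 Ω))) : γ x = x := by
  -- A fast subsequence makes the numbers `‖(a_{φ n} - x)Ω‖²` summable, as `tendsto_re_inner_aut`
  -- requires.
  obtain ⟨φ, hφ, hφ'⟩ : ∃ φ : ℕ → ℕ, StrictMono φ ∧
      ∀ n, ‖((a (φ n)).1 - x.1) Ω‖ ≤ (1 / 2) ^ n := by
    refine extraction_forall_of_eventually (P := fun n k => ‖((a k).1 - x.1) Ω‖ ≤ (1 / 2) ^ n)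
      fun n => ?_
    have := (tendsto_iff_norm_sub_tendsto_zero.1 hlim).eventually_le_const
      (show (0 : ℝ) < (1 / 2) ^ n by positivity)
    exact this
  let D : ℝ := C + ‖x.1‖ + 1
  have hC : 0 ≤ C := (norm_nonneg _).trans (ha 0)
  have hD : 0 < D := by positivity
  let d : ℕ → S.toStarSubalgebra := fun n => a (φ n) - x
  have hd : ∀ n, ‖(d n).1‖ ≤ D := fun n =>
    (norm_sub_le (a (φ n)).1 x.1).trans (by linarith [ha (φ n)])
  let y : ℕ → S.toStarSubalgebra := fun n =>
    star ((D : ℂ)⁻¹ • d n) * ((D : ℂ)⁻¹ • d n)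
  have hre : ∀ (T : S.toStarSubalgebra) (ξ : H), (⟪(star T * T).1 ξ, ξ⟫_ℂ).re = ‖T.1 ξ‖ ^ 2 := by
    intro T ξ
    have h2 : ⟪(star T * T).1 ξ, ξ⟫_ℂ = ⟪T.1 ξ, T.1 ξ⟫_ℂ :=
      ContinuousLinearMap.adjoint_inner_left T.1 ξ (T.1 ξ)
    rw [h2, inner_self_eq_norm_sq_to_K]
    norm_cast
  have hnorm : ∀ (T : S.toStarSubalgebra) (ξ : H),
      ‖((D : ℂ)⁻¹ • T).1 ξ‖ ^ 2 = (D ^ 2)⁻¹ * ‖T.1 ξ‖ ^ 2 := by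
    intro T ξ
    change ‖(D : ℂ)⁻¹ • T.1 ξ‖ ^ 2 = _
    rw [norm_smul, mul_pow, norm_inv, Complex.norm_real, Real.norm_of_nonneg hD.le, inv_pow]
  have hy1 : ∀ n, (y n).1 ≤ 1 := fun n => by
    have h2 : ‖((D : ℂ)⁻¹ • d n).1‖ ≤ 1 := by
      change ‖(D : ℂ)⁻¹ • (d n).1‖ ≤ 1
      rw [norm_smul, norm_inv, Complex.norm_real, Real.norm_of_nonneg hD.le, inv_mul_le_one₀ hD]
      exact hd n
    have h3 : ‖(y n).1‖ ≤ 1 := by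
      change ‖star ((D : ℂ)⁻¹ • d n).1 * ((D : ℂ)⁻¹ • d n).1‖ ≤ 1
      rw [CStarRing.norm_star_mul_self]
      exact mul_le_one₀ h2 (norm_nonneg _) h2
    exact (CStarAlgebra.norm_le_one_iff_of_nonneg (y n).1
      (star_mul_self_nonneg ((D : ℂ)⁻¹ • d n).1)).1 h3
  have hsum : Summable fun n => (⟪(y n).1 Ω, Ω⟫_ℂ).re := by
    have h2 : Summable fun n : ℕ => (D ^ 2)⁻¹ * (1 / 4 : ℝ) ^ n :=
      (summable_geometric_of_lt_one (by norm_num) (by norm_num)).mul_left _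
    refine h2.of_nonneg_of_le (fun n => ?_) fun n => ?_
    · rw [hre]
      positivity
    · rw [hre, hnorm]
      refine mul_le_mul_of_nonneg_left ?_ (by positivity)
      have h3 := pow_le_pow_left₀ (norm_nonneg _) (hφ' n) 2
      rw [← pow_mul, mul_comm n, pow_mul] at h3
      norm_num at h3 ⊢
      exact h3
  have h2 := tendsto_re_inner_aut γ hsep (y := y)
    (fun n => star_mul_self_nonneg ((D : ℂ)⁻¹ • d n).1) hy1 hsum
  -- Since `γ` fixes each `aₙ`, it sends `|a_{φ n} - x|² / D²` to `|a_{φ n} - γ(x)|² / D²`.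
  have h3 : ∀ n, (⟪(γ (y n)).1 Ω, Ω⟫_ℂ).re = (D ^ 2)⁻¹ * ‖(a (φ n)).1 Ω - (γ x).1 Ω‖ ^ 2 := by
    intro n
    have h4 : γ (y n) = star ((D : ℂ)⁻¹ • (a (φ n) - γ x)) * ((D : ℂ)⁻¹ • (a (φ n) - γ x)) := by
      have h5 : γ ((D : ℂ)⁻¹ • d n) = (D : ℂ)⁻¹ • (a (φ n) - γ x) := by
        rw [← hγ (φ n), ← map_sub]
        exact map_smul γ _ _
      rw [map_mul, map_star, h5]
    rw [h4, hre, hnorm]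
    rfl
  simp_rw [h3] at h2
  have h4 : Tendsto (fun n => ‖(a (φ n)).1 Ω - (γ x).1 Ω‖ ^ 2) atTop (𝓝 0) := by
    have := h2.const_mul (D ^ 2)
    rw [mul_zero] at this
    refine this.congr fun n => ?_
    rw [mul_inv_cancel_left₀ (by positivity)]
  have h5 : Tendsto (fun n => ‖(a (φ n)).1 Ω - (γ x).1 Ω‖) atTop (𝓝 0) := by
    have := h4.sqrt
    simpa [Real.sqrt_sq (norm_nonneg _)] using this
  have h6 : x.1 Ω = (γ x).1 Ω := tendsto_nhds_unique (hlim.comp hφ.tendsto_atTop)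
    (tendsto_iff_norm_sub_tendsto_zero.2 h5)
  have h7 := hsep (γ x - x).1 (γ x - x).2 (by
    change (γ x).1 Ω - x.1 Ω = 0
    rw [h6, sub_self])
  exact sub_eq_zero.1 (Subtype.ext h7)

end Operators

/-! ### Right multiplications and the separating vector `Ω` -/

section RightMultiplication

variable {τ : ℝ} (P : MarkovInclusion.{u} τ)

/-- The inclusion of `M_∞` in `L²(M_∞, tr)`. -/
def towerVec : TowerUnion P →ₗ[ℂ] TowerL2 P :=
  (UniformSpace.Completion.toComplₗᵢ (𝕜 := ℂ)).toLinearMap ∘ₗ (toL2 (unionTr_state P)).toLinearMap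

lemma towerVec_def (a : TowerUnion P) :
    towerVec P a = (toL2 (unionTr_state P) a : TowerL2 P) := rfl

lemma denseRange_towerVec : DenseRange (towerVec P) :=
  UniformSpace.Completion.denseRange_coe.comp (toL2 (unionTr_state P)).surjective.denseRange
    (UniformSpace.Completion.continuous_coe _)

lemma inner_towerVec (a b : TowerUnion P) :
    ⟪towerVec P a, towerVec P b⟫_ℂ = unionTr P (star a * b) := by
  rw [towerVec_def, towerVec_def, UniformSpace.Completion.inner_coe, inner_toL2]

lemma norm_sq_towerVec (a : TowerUnion P) :
    ((‖towerVec P a‖ ^ 2 : ℝ) : ℂ) = unionTr P (star a * a) := by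
  rw [← inner_towerVec, inner_self_eq_norm_sq_to_K]
  norm_cast

lemma norm_towerVec_le_iff {a b : TowerUnion P} {C : ℝ} (hC : 0 ≤ C) :
    unionTr P (star a * a) ≤ ((C ^ 2 : ℝ) : ℂ) * unionTr P (star b * b) ↔
      ‖towerVec P a‖ ≤ C * ‖towerVec P b‖ := by
  rw [← norm_sq_towerVec, ← norm_sq_towerVec, ← Complex.ofReal_mul, Complex.real_le_real, ← mul_pow]
  exact pow_le_pow_iff_left₀ (norm_nonneg _) (by positivity) two_ne_zero

/-- Traciality makes the adjoint isometric for the `L²` norm, which reduces the claim to left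
multiplication by `b*`. -/
lemma exists_right_bound (b : TowerUnion P) :
    ∃ C : ℝ, ∀ x, ‖towerVec P (x * b)‖ ≤ C * ‖towerVec P x‖ := by
  obtain ⟨C, hC0, hC⟩ := exists_bound P (star b)
  refine ⟨√C, fun x => (norm_towerVec_le_iff P (Real.sqrt_nonneg C)).1 ?_⟩
  have h1 := hC (star x)
  rw [Real.sq_sqrt hC0, (unionTr_state P).tracial, (unionTr_state P).tracial (star x)]
  simpa using h1

/-- Right multiplication by `b ∈ M_∞` on `L²(M_∞, tr)`. -/
def rightRep (b : TowerUnion P) : TowerL2 P →L[ℂ] TowerL2 P :=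
  (LinearMap.mkContinuousOfExistsBound
    ((toL2 (unionTr_state P)).toLinearMap ∘ₗ LinearMap.mulRight ℂ b ∘ₗ
      (toL2 (unionTr_state P)).symm.toLinearMap) (by
    obtain ⟨C, hC⟩ := exists_right_bound P b
    refine ⟨C, fun x => ?_⟩
    have h1 := hC ((toL2 (unionTr_state P)).symm x)
    rw [towerVec_def, towerVec_def, UniformSpace.Completion.norm_coe,
      UniformSpace.Completion.norm_coe] at h1
    exact h1)).completion

lemma rightRep_towerVec (b a : TowerUnion P) :
    rightRep P b (towerVec P a) = towerVec P (a * b) := by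
  rw [towerVec_def, rightRep, ContinuousLinearMap.completion_apply_coe]
  rfl

lemma gnsRep_towerVec (a b : TowerUnion P) :
    gnsRep P a (towerVec P b) = towerVec P (a * b) := gnsRep_coe a b

lemma rightRep_mul_gnsRep (a b : TowerUnion P) :
    rightRep P b * gnsRep P a = gnsRep P a * rightRep P b := by
  refine completion_ext P fun c => ?_
  change rightRep P b (gnsRep P a (towerVec P c)) = gnsRep P a (rightRep P b (towerVec P c))
  rw [gnsRep_towerVec, rightRep_towerVec, rightRep_towerVec, gnsRep_towerVec, mul_assoc]

lemma inner_rightRep (b : TowerUnion P) (ξ η : TowerL2 P) :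
    ⟪rightRep P b ξ, η⟫_ℂ = ⟪ξ, rightRep P (star b) η⟫_ℂ := by
  induction ξ, η using UniformSpace.Completion.induction_on₂ with
  | hp => apply isClosed_eq <;> fun_prop
  | ih x y =>
    obtain ⟨x, rfl⟩ := (toL2 (unionTr_state P)).surjective x
    obtain ⟨y, rfl⟩ := (toL2 (unionTr_state P)).surjective y
    change ⟪rightRep P b (towerVec P x), towerVec P y⟫_ℂ =
      ⟪towerVec P x, rightRep P (star b) (towerVec P y)⟫_ℂ
    rw [rightRep_towerVec, rightRep_towerVec, inner_towerVec, inner_towerVec, star_mul, mul_assoc,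
      (unionTr_state P).tracial, mul_assoc]

lemma factorR_towerVec {x : TowerL2 P →L[ℂ] TowerL2 P} (hx : x ∈ FactorR P) (b : TowerUnion P) :
    x (towerVec P b) = rightRep P b (x (towerVec P 1)) := by
  have h1 := mem_factorR_iff.1 hx (rightRep P b) fun a => rightRep_mul_gnsRep P a b
  have h2 := congrArg (fun T : TowerL2 P →L[ℂ] TowerL2 P => T (towerVec P 1)) h1
  refine Eq.trans ?_ h2.symm
  change _ = x (rightRep P b (towerVec P 1))
  rw [rightRep_towerVec, one_mul]

/-- Right multiplications commute with `R`, so `x` is determined by `xΩ` on the dense subspace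
`M_∞Ω`. -/
lemma factorR_separating {x : TowerL2 P →L[ℂ] TowerL2 P} (hx : x ∈ FactorR P)
    (h0 : x (towerVec P 1) = 0) : x = 0 :=
  completion_ext P fun b => by
    change x (towerVec P b) = 0
    rw [factorR_towerVec P hx, h0, map_zero]

end RightMultiplication

/-! ### Bounded approximation of `R` by the tower -/

section Approximation

variable {τ : ℝ} (P : MarkovInclusion.{u} τ)

lemma unionIncl_towerMap {m n : ℕ} (hmn : m ≤ n) (x : (tower P m).Alg) :
    unionIncl P n (towerMap P m n hmn x) = unionIncl P m x :=
  DirectLimit.mk_apply (f := towerMap P) _ _ _ _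

/-- A bound for the multiplication by `a ∈ M_m` on `L²(M_m)` is one on `L²(M_∞)`. -/
lemma union_bound {m : ℕ} {a : (tower P m).Alg} {C : ℝ}
    (hC : ∀ x, (tower P m).tr (star (a * x) * (a * x)) ≤ C * (tower P m).tr (star x * x))
    (y : TowerUnion P) :
    unionTr P (star (unionIncl P m a * y) * (unionIncl P m a * y)) ≤
      C * unionTr P (star y * y) := by
  induction y using DirectLimit.induction with
  | ih k y =>
    change unionTr P (star (unionIncl P m a * unionIncl P k y) *
      (unionIncl P m a * unionIncl P k y)) ≤
        C * unionTr P (star (unionIncl P k y) * unionIncl P k y)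
    rw [← unionIncl_towerMap P (le_max_left m k), ← unionIncl_towerMap P (le_max_right m k)]
    simp only [← map_mul (unionIncl P (max m k)), ← map_star (unionIncl P (max m k)), unionTr_incl]
    exact towerMap_bound P m _ (le_max_left _ _) a hC _

lemma norm_gnsRep_le {a : TowerUnion P} {C : ℝ} (hC0 : 0 ≤ C)
    (hC : ∀ y, ‖towerVec P (a * y)‖ ≤ C * ‖towerVec P y‖) : ‖gnsRep P a‖ ≤ C := by
  refine ContinuousLinearMap.opNorm_le_bound _ hC0 fun ξ => ?_
  refine (denseRange_towerVec P).induction_on ξ (isClosed_le (by fun_prop) (by fun_prop))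
    fun y => ?_
  rw [gnsRep_towerVec]
  exact hC y

/-- The subspace `L²(M_n, tr)` of `L²(M_∞, tr)`. -/
def levelSpace (n : ℕ) : Submodule ℂ (TowerL2 P) :=
  LinearMap.range (towerVec P ∘ₗ (unionIncl P n).toAlgHom.toLinearMap)

lemma mem_levelSpace {n : ℕ} {ξ : TowerL2 P} :
    ξ ∈ levelSpace P n ↔ ∃ a, towerVec P (unionIncl P n a) = ξ := Iff.rfl

instance (n : ℕ) : FiniteDimensional ℂ (levelSpace P n) :=
  LinearMap.finiteDimensional_range _

lemma levelSpace_mono : Monotone (levelSpace P) := by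
  rintro m n hmn _ ⟨a, rfl⟩
  exact ⟨towerMap P m n hmn a, congrArg (towerVec P) (unionIncl_towerMap P hmn a)⟩

lemma top_le_closure_levelSpace : ⊤ ≤ (⨆ n, levelSpace P n).topologicalClosure := by
  intro ξ _
  refine (denseRange_towerVec P).induction_on ξ
    (Submodule.isClosed_topologicalClosure _) fun y => ?_
  refine Submodule.le_topologicalClosure _ ?_
  induction y using DirectLimit.induction with
  | ih n y => exact Submodule.mem_iSup_of_mem n ⟨y, rfl⟩

/-- The conditional expectation of `R` onto `M_n` decreases the norm. -/
lemma exists_level_approx {x : TowerL2 P →L[ℂ] TowerL2 P} (hx : x ∈ FactorR P) (n : ℕ) :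
    ∃ a : (tower P n).Alg,
      towerVec P (unionIncl P n a) = (levelSpace P n).starProjection (x (towerVec P 1)) ∧
        ‖gnsRep P (unionIncl P n a)‖ ≤ ‖x‖ := by
  obtain ⟨a, ha⟩ := (mem_levelSpace P).1
    (Submodule.starProjection_apply_mem (levelSpace P n) (x (towerVec P 1)))
  have hin : ∀ c : (tower P n).Alg, ⟪towerVec P (unionIncl P n c), towerVec P (unionIncl P n a)⟫_ℂ =
      ⟪towerVec P (unionIncl P n c), x (towerVec P 1)⟫_ℂ := by
    intro c
    rw [ha, ← sub_eq_zero, ← inner_sub_right, ← inner_conj_symm, map_eq_zero, ← neg_sub,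
      inner_neg_left, neg_eq_zero]
    exact Submodule.starProjection_inner_eq_zero _ _ ⟨c, rfl⟩
  -- On `L²(M_n)` left multiplication by `a` is the compression of `x`: moving `b` across the inner
  -- product by right multiplication reduces this to `aΩ` being the projection of `xΩ`.
  have hmul : ∀ b c : (tower P n).Alg,
      ⟪towerVec P (unionIncl P n c), towerVec P (unionIncl P n (a * b))⟫_ℂ =
        ⟪towerVec P (unionIncl P n c), x (towerVec P (unionIncl P n b))⟫_ℂ := by
    intro b c
    rw [factorR_towerVec P hx, ← star_star (unionIncl P n b), ← inner_rightRep, rightRep_towerVec,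
      ← map_star, ← map_mul, ← hin, map_mul (unionIncl P n), map_mul (unionIncl P n),
      ← rightRep_towerVec, ← rightRep_towerVec,
      inner_rightRep, map_star, star_star]
  have hb : ∀ b : (tower P n).Alg, ‖towerVec P (unionIncl P n a * unionIncl P n b)‖ ≤
      ‖x‖ * ‖towerVec P (unionIncl P n b)‖ := by
    intro b
    rw [← map_mul]
    have h1 : ‖towerVec P (unionIncl P n (a * b))‖ ^ 2 ≤
        ‖towerVec P (unionIncl P n (a * b))‖ * (‖x‖ * ‖towerVec P (unionIncl P n b)‖) := by
      rw [← inner_self_eq_norm_sq (𝕜 := ℂ), hmul]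
      refine (Complex.re_le_norm _).trans ((norm_inner_le_norm _ _).trans ?_)
      exact mul_le_mul_of_nonneg_left (x.le_opNorm _) (norm_nonneg _)
    rcases (norm_nonneg (towerVec P (unionIncl P n (a * b)))).eq_or_lt with h0 | h0
    · rw [← h0]
      positivity
    · rw [sq] at h1
      exact le_of_mul_le_mul_left h1 h0
  refine ⟨a, ha, norm_gnsRep_le P (norm_nonneg x) fun y => ?_⟩
  rw [← norm_towerVec_le_iff P (norm_nonneg x)]
  -- The compression bounds `a` by `‖x‖` only on `L²(M_n)`; the Markov property carries the same
  -- constant to all higher levels.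
  refine union_bound P (fun b => ?_) y
  have h1 := (norm_towerVec_le_iff P (norm_nonneg x)).2 (hb b)
  simp only [← map_mul (unionIncl P n), ← map_star (unionIncl P n), unionTr_incl] at h1
  exact h1

/-- An automorphism of `R` that fixes every `M_n` pointwise is the identity. -/
lemma factorR_aut_eq_self (γ : FactorR P ≃⋆ₐ[ℂ] FactorR P)
    (hγ : ∀ n x, γ (toR P n x) = toR P n x) (x : FactorR P) : γ x = x := by
  choose a ha hn using exists_level_approx P x.2
  have hlim : Filter.Tendsto (fun n => (toR P n (a n)).1 (towerVec P 1)) Filter.atTop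
      (nhds (x.1 (towerVec P 1))) := by
    have h1 := Submodule.starProjection_tendsto_self (levelSpace P) (levelSpace_mono P)
      (x.1 (towerVec P 1)) (top_le_closure_levelSpace P)
    refine h1.congr fun n => ?_
    have h2 := gnsRep_towerVec P (unionIncl P n (a n)) 1
    rw [mul_one] at h2
    exact (ha n).symm.trans h2.symm
  have hsep : ∀ y ∈ factorR P, y (towerVec P 1) = 0 → y = 0 :=
    fun y hy h0 => factorR_separating P hy h0
  exact aut_eq_of_tendsto (S := factorR P) γ hsep (fun n => hγ n (a n)) hn hlim

end Approximation

/-! ### Uniqueness of the compatible extension -/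

section CompatibleExtension

variable {τ : ℝ} {P : MarkovInclusion.{u} τ}

lemma apply_eq_of_exists_sum {H A C : Type*} [NormedAddCommGroup H] [InnerProductSpace ℂ H]
    [CompleteSpace H] [Ring A] [StarRing A] [Algebra ℂ A] {S : VonNeumannAlgebra H}
    (f : A →⋆ₐ[ℂ] S.toStarSubalgebra) {α β : S.toStarSubalgebra ≃⋆ₐ[ℂ] S.toStarSubalgebra}
    {g : C → A} {p x : A}
    (hx : ∃ (k : ℕ) (u v : Fin k → C), x = ∑ i, g (u i) * p * g (v i))
    (hg : ∀ c, α (f (g c)) = β (f (g c))) (hp : α (f p) = β (f p)) : α (f x) = β (f x) := by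
  obtain ⟨k, u, v, hx⟩ := hx
  rw [hx, map_sum f]
  refine (map_sum α _ _).trans (Eq.trans ?_ (map_sum β _ _).symm)
  refine Finset.sum_congr rfl fun i _ => ?_
  rw [map_mul f, map_mul f, map_mul α, map_mul α, map_mul β, map_mul β, hg, hp, hg]

lemma symm_trans_apply_of_eq {H : Type*} [NormedAddCommGroup H] [InnerProductSpace ℂ H]
    [CompleteSpace H]
    {S : VonNeumannAlgebra H} {α β : S.toStarSubalgebra ≃⋆ₐ[ℂ] S.toStarSubalgebra}
    {y z : S.toStarSubalgebra} (hα : α y = z) (hβ : β y = z) : (α.symm.trans β) z = z := by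
  change β (α.symm z) = z
  rw [← hα, StarAlgEquiv.symm_apply_apply, hβ, hα]

lemma eq_of_symm_trans_eq_self {H : Type*} [NormedAddCommGroup H] [InnerProductSpace ℂ H]
    [CompleteSpace H]
    {S : VonNeumannAlgebra H} {α β : S.toStarSubalgebra ≃⋆ₐ[ℂ] S.toStarSubalgebra}
    (h : ∀ x, (α.symm.trans β) x = x) : β = α := by
  refine DFunLike.ext β α fun x => ?_
  have h2 : β (α.symm (α x)) = α x := h (α x)
  rwa [StarAlgEquiv.symm_apply_apply] at h2

lemma toR_towerIncl (n : ℕ) (x : (tower P n).Alg) :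
    toR P (n + 1) (towerIncl P n x) = toR P n x := by
  have h1 := unionIncl_towerMap P (Nat.le_succ n) x
  rw [towerMap_succ P n n le_rfl, towerMap_self] at h1
  exact Subtype.ext (congrArg (gnsRep P) h1)

lemma exists_eq_sum_towerProj (n : ℕ) (x : (tower P (n + 1)).Alg) :
    ∃ (k : ℕ) (u v : Fin k → (tower P n).Alg),
      x = ∑ i, towerIncl P n (u i) * towerProj P n * towerIncl P n (v i) := by
  obtain ⟨k, g, hg⟩ := exists_basis (tower P n).markov.state (tower P n).sub
  exact ⟨k, _, _, basic_eq_sum hg x⟩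

lemma IsCompatibleExtension.eq_on_level {α₀ : P.Alg ≃⋆ₐ[ℂ] P.Alg}
    {α β : FactorR P ≃⋆ₐ[ℂ] FactorR P} (hα : IsCompatibleExtension P α₀ α)
    (hβ : IsCompatibleExtension P α₀ β) (n : ℕ) (x : (tower P n).Alg) :
    α (toR P n x) = β (toR P n x) := by
  induction n with
  | zero => exact (hα.extends_base x).trans (hβ.extends_base x).symm
  | succ n ih =>
    have h1 : ∀ y, α (toR P (n + 1) (towerIncl P n y)) = β (toR P (n + 1) (towerIncl P n y)) :=
      fun y => (congrArg α (toR_towerIncl n y)).trans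
        ((ih y).trans (congrArg β (toR_towerIncl n y)).symm)
    exact apply_eq_of_exists_sum (S := factorR P) (toR P (n + 1)) (exists_eq_sum_towerProj n x) h1
      ((hα.fixes_proj n).trans (hβ.fixes_proj n).symm)

lemma IsCompatibleExtension.unique {α₀ : P.Alg ≃⋆ₐ[ℂ] P.Alg}
    {α β : FactorR P ≃⋆ₐ[ℂ] FactorR P} (hα : IsCompatibleExtension P α₀ α)
    (hβ : IsCompatibleExtension P α₀ β) : β = α := by
  have h1 : ∀ n x, (α.symm.trans β) (toR P n x) = toR P n x := by
    intro n x
    -- Invariance of `M_n` places `α⁻¹(x)` in `M_n`, where `α` and `β` are known to agree.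
    have hx : toR P n x ∈ α '' Set.range (toR P n) := (hα.map_level n).ge ⟨x, rfl⟩
    obtain ⟨z, ⟨y, hyz⟩, hz⟩ := hx
    have hy : α (toR P n y) = toR P n x := (congrArg α hyz).trans hz
    exact symm_trans_apply_of_eq (S := factorR P) hy ((hα.eq_on_level hβ n y).symm.trans hy)
  exact eq_of_symm_trans_eq_self (S := factorR P) (factorR_aut_eq_self P (α.symm.trans β) h1)

end CompatibleExtension

end JonesTower

end

theorem mainTheorem5 {M : Type*} [CStarAlgebra M] [FiniteDimensional ℂ M]
    (N : StarSubalgebra ℂ M) (hconn : JonesTower.IsConnectedInclusion N)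
    (tr : M →ₗ[ℂ] ℂ) (τ : ℝ) (htr : JonesTower.IsMarkovTrace N tr τ)
    (α₀ : M ≃⋆ₐ[ℂ] M) (hα₀ : α₀ '' (N : Set M) = N) :
    let P : JonesTower.MarkovInclusion τ := ⟨M, N, tr, htr⟩
    ∃ α : JonesTower.FactorR P ≃⋆ₐ[ℂ] JonesTower.FactorR P,
      JonesTower.IsCompatibleExtension P α₀ α ∧
      (∀ x, JonesTower.trR P (α x) = JonesTower.trR P x) ∧
      ∀ β : JonesTower.FactorR P ≃⋆ₐ[ℂ] JonesTower.FactorR P,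
        JonesTower.IsCompatibleExtension P α₀ β → β = α := by
  intro P
  let σ : P.Aut := ⟨α₀, JonesTower.markovTrace_map hconn htr α₀ hα₀, hα₀⟩
  have hα := JonesTower.factorAut_isCompatibleExtension σ
  exact ⟨JonesTower.factorAut σ, hα, JonesTower.trR_factorAut σ, fun β hβ => hα.unique hβ⟩
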